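/- Let $n\ge 2$, let $B_1\subset\mathbb{R}^n$ be the open unit ball, let $\lambda\ge 0$, and let $f\colon[0,\infty)\to[0,\infty)$ be a $C^2$ function with $f'>0$ on $(0,\infty)$. Let $(\alpha,\psi)$, with $\alpha>0$ and $\psi\in C^2(\overline{B_1})$, satisfy $$-\Delta\psi=f(\alpha+\lambda\psi)\ \text{ and }\ \psi>0\ \text{ in }B_1,\qquad \psi=0\ \text{ on }\partial B_1,\qquad \int_{B_1}f(\alpha+\lambda\psi)\,dx=1,$$ and put $V=f'(\alpha+\lambda\psi)$, so that $V>0$ on $\overline{B_1}$. For $\phi\in L^2(B_1)$ put $\langle\phi\rangle=\int_{B_1}V\phi\,\big/\int_{B_1}V$ and $[\phi]=\phi-\langle\phi\rangle$. An eigenfunction of $\sigma\in\mathbb{R}$ is a $\phi\in H^1_0(B_1)\setminus\{0\}$ solving $-\Delta\phi-\lambda V[\phi]=\sigma V[\phi]$ weakly in $B_1$, and the first eigenvalue is $$\sigma_1=\inf_{\phi\in H^1_0(B_1)\setminus\{0\}}\frac{\int_{B_1}|\nabla\phi|^2-\lambda\int_{B_1}V[\phi]^2}{\int_{B_1}V[\phi]^2}.$$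 Let $\phi=\phi(r)$, $r=|x|$, be a radial eigenfunction of $\sigma_1$, represented by a continuous function on $[0,1]$. Replacing $\phi$ by $-\phi$ if necessary, assume $\langle\phi\rangle\ge 0$. A singular point of $\phi$ is an $r_0\in[0,1]$ with $\phi(r_0)=\phi'(r_0)=0$ and $\phi''(r_0)>0$ (one-sided derivatives at $0$ and $1$). A generalized nodal domain of $\phi$ is a nonempty open connected radially symmetric set $\Omega_0\subseteq B_1$ such that * $\phi=0$ on $\partial\Omega_0$, and $\phi'(|x|)\ne 0$ for every $x\in\partial\Omega_0$ with $|x|<1$; * either $\phi<0$ in $\Omega_0$, or $\phi\ge 0$ in $\Omega_0$ and $\phi>0$ in $\Omega_0$ except possibly on finitely many spheres $\{|x|=r_i\}$ whose radii $r_i$ are singular points of $\phi$. Then $\phi$ has at most two generalized nodal domains. -/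

import Mathlib

open Set Filter Topology MeasureTheory
open scoped ContDiff

noncomputable section

namespace MeanField

variable {n : ℕ}

/-- The open unit ball `B₁` of `ℝⁿ`. -/
def unitBall (n : ℕ) : Set (EuclideanSpace ℝ (Fin n)) := Metric.ball 0 1

/-- The nonlinearity: a `C²` function `f : [0, ∞) → [0, ∞)` with `f' > 0` in `(0, ∞)`.
Values of `f` at negative arguments are irrelevant. -/
structure IsNonlinearity (f : ℝ → ℝ) : Prop where
  contDiffOn : ContDiffOn ℝ 2 f (Ici 0)
  nonneg : ∀ t, 0 ≤ t → 0 ≤ f t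
  deriv_pos : ∀ t, 0 < t → 0 < deriv f t

/-- `(α, ψ)` is a solution, with `ψ ∈ C²` up to the boundary, of the constrained problem
`-Δψ = f (α + lam ψ)` in `B₁`, `∫ f (α + lam ψ) = 1`, `α > 0`, `ψ > 0` in `B₁`, `ψ = 0` on `∂B₁`.
Values of `ψ` outside the closed ball are irrelevant. -/
structure IsSolution (f : ℝ → ℝ) (lam α : ℝ) (ψ : EuclideanSpace ℝ (Fin n) → ℝ) : Prop where
  contDiffOn : ContDiffOn ℝ 2 ψ (closure (unitBall n))
  equation : ∀ x ∈ unitBall n, -Laplacian.laplacian ψ x = f (α + lam * ψ x)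
  constraint : ∫ x in unitBall n, f (α + lam * ψ x) = 1
  alpha_pos : 0 < α
  pos : ∀ x ∈ unitBall n, 0 < ψ x
  boundary : ∀ x ∈ frontier (unitBall n), ψ x = 0

/-- The weight `V = f' (α + lam ψ)`. -/
def weight (f : ℝ → ℝ) (lam α : ℝ) (ψ : EuclideanSpace ℝ (Fin n) → ℝ) :
    EuclideanSpace ℝ (Fin n) → ℝ :=
  fun x => deriv f (α + lam * ψ x)

/-- `η ∈ C_c^∞(Ω)`. -/
def IsTestFunction (Ω : Set (EuclideanSpace ℝ (Fin n)))
    (η : EuclideanSpace ℝ (Fin n) → ℝ) : Prop :=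
  ContDiff ℝ ∞ η ∧ HasCompactSupport η ∧ tsupport η ⊆ Ω

/-- `φ ∈ H¹₀(Ω)`, with weak gradient `G`: the pair `(φ, G)` is the limit in `L²(Ω)` of pairs
`(η k, ∇ (η k))` with `η k ∈ C_c^∞(Ω)`. Functions are taken up to null sets of `Ω`. -/
def MemH10 (Ω : Set (EuclideanSpace ℝ (Fin n))) (φ : EuclideanSpace ℝ (Fin n) → ℝ)
    (G : EuclideanSpace ℝ (Fin n) → EuclideanSpace ℝ (Fin n)) : Prop :=
  MemLp φ 2 (volume.restrict Ω) ∧ MemLp G 2 (volume.restrict Ω) ∧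
  ∃ η : ℕ → EuclideanSpace ℝ (Fin n) → ℝ,
    (∀ k, IsTestFunction Ω (η k)) ∧
    Tendsto (fun k => eLpNorm (fun x => η k x - φ x) 2 (volume.restrict Ω)) atTop (𝓝 0) ∧
    Tendsto (fun k => eLpNorm (fun x => gradient (η k) x - G x) 2 (volume.restrict Ω))
      atTop (𝓝 0)

/-- The weighted average `⟨φ⟩ = ∫ V φ / ∫ V` over the unit ball. -/
def average (V φ : EuclideanSpace ℝ (Fin n) → ℝ) : ℝ :=
  (∫ x in unitBall n, V x * φ x) / ∫ x in unitBall n, V x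

/-- The oscillation `[φ] = φ - ⟨φ⟩`. -/
def oscillation (V φ : EuclideanSpace ℝ (Fin n) → ℝ) : EuclideanSpace ℝ (Fin n) → ℝ :=
  fun x => φ x - average V φ

/-- `φ ∈ H¹₀(B₁) \ {0}` is a weak solution of `-Δφ - lam V [φ] = σ V [φ]`. -/
def IsEigenfunction (lam : ℝ) (V : EuclideanSpace ℝ (Fin n) → ℝ) (σ : ℝ)
    (φ : EuclideanSpace ℝ (Fin n) → ℝ) : Prop :=
  (¬ φ =ᵐ[volume.restrict (unitBall n)] 0) ∧
  ∃ G : EuclideanSpace ℝ (Fin n) → EuclideanSpace ℝ (Fin n), MemH10 (unitBall n) φ G ∧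
    ∀ η : EuclideanSpace ℝ (Fin n) → ℝ, IsTestFunction (unitBall n) η →
      (∫ x in unitBall n, inner ℝ (G x) (gradient η x))
          - lam * ∫ x in unitBall n, V x * oscillation V φ x * η x
        = σ * ∫ x in unitBall n, V x * oscillation V φ x * η x

/-- The first eigenvalue: the infimum over `φ ∈ H¹₀(B₁) \ {0}` of the Rayleigh quotient
`(∫ |∇φ|² - lam ∫ V [φ]²) / ∫ V [φ]²`. -/
def firstEigenvalue (lam : ℝ) (V : EuclideanSpace ℝ (Fin n) → ℝ) : ℝ :=
  sInf {ρ : ℝ | ∃ (φ : EuclideanSpace ℝ (Fin n) → ℝ)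
      (G : EuclideanSpace ℝ (Fin n) → EuclideanSpace ℝ (Fin n)),
    MemH10 (unitBall n) φ G ∧ (¬ φ =ᵐ[volume.restrict (unitBall n)] 0) ∧
    ρ = ((∫ x in unitBall n, ‖G x‖ ^ 2)
          - lam * ∫ x in unitBall n, V x * oscillation V φ x ^ 2)
        / ∫ x in unitBall n, V x * oscillation V φ x ^ 2}

/-- The function `x ↦ u |x|` with radial profile `u : [0, 1] → ℝ`. -/
def radialFun (n : ℕ) (u : ℝ → ℝ) : EuclideanSpace ℝ (Fin n) → ℝ := fun x => u ‖x‖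

/-- `u'` on `[0, 1]`, one-sided at the end points. -/
def radialDeriv (u : ℝ → ℝ) : ℝ → ℝ := derivWithin u (Icc 0 1)

/-- A singular point of the profile `u`: `r ∈ [0, 1]` with `u = u' = 0` and `u'' > 0` at `r`. -/
def IsSingularPoint (u : ℝ → ℝ) (r : ℝ) : Prop :=
  r ∈ Icc (0 : ℝ) 1 ∧ u r = 0 ∧ radialDeriv u r = 0 ∧ 0 < radialDeriv (radialDeriv u) r

/-- A radial domain in `B₁`: open, connected, nonempty and a union of spheres centred at `0`. -/
structure IsRadialDomain (D : Set (EuclideanSpace ℝ (Fin n))) : Prop where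
  isOpen : IsOpen D
  isConnected : IsConnected D
  subset : D ⊆ unitBall n
  radial : ∀ x y, ‖x‖ = ‖y‖ → x ∈ D → y ∈ D

/-- A generalized nodal domain of the radial function with profile `u` (normalized to have
nonnegative average): a radial domain `D` such that `u = 0` on `∂D`, `u' ≠ 0` on the part of `∂D`
inside `B₁`, and in `D` either `u < 0`, or `u ≥ 0` and `u > 0` off finitely many spheres
whose radii are singular points. -/
structure IsGeneralizedNodalDomain (u : ℝ → ℝ) (D : Set (EuclideanSpace ℝ (Fin n))) : Prop where
  radialDomain : IsRadialDomain D
  boundary_zero : ∀ x ∈ frontier D, u ‖x‖ = 0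
  boundary_deriv : ∀ x ∈ frontier D, ‖x‖ < 1 → radialDeriv u ‖x‖ ≠ 0
  sign : (∀ x ∈ D, u ‖x‖ < 0) ∨
    ((∀ x ∈ D, 0 ≤ u ‖x‖) ∧
      ∃ S : Finset ℝ, (∀ r ∈ S, IsSingularPoint u r) ∧ ∀ x ∈ D, ‖x‖ ∉ S → 0 < u ‖x‖)

end MeanField

end

/-! Write μ = lam + σ₁ and m = ⟨φ⟩, and let M(r) be the integral of V[φ] over the ball of radius r.
The equation reads -Δφ = μ V[φ], and for a radial φ with profile u it integrates to u' = -μ M(r) /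
(n |B₁| r^(n-1)) with u(1) = 0 (`radial_profile_eq`, `radial_profile_one_eq_zero`). Only radial test
functions are needed for this, so V itself need not be radial: it enters through its integrals over
balls. Since V[φ] has zero integral, M(1) = 0, and so u'(1) = 0 as well.

If m = 0, the vanishing data at r = 1 force u = 0 (`eq_zero_of_average_eq_zero`); hence m > 0. Near
the boundary φ is then smaller than m, so M > 0, u' < 0, and u is positive just inside the sphere
(`exists_pos_near_one`). There is thus a last interval (d, 1) of positivity.

The heart is `IsPosInterval.false_of_le`: u cannot have two disjoint positivity intervals. Truncate
φ to the two shells, obtaining w₁, w₂ ≥ 0 with ∫|∇wᵢ|² = μ (∫ V wᵢ² - m ∫ V wᵢ). The combination w =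
c₁ w₁ - c₂ w₂ with c₁ = ∫ V w₂ and c₂ = ∫ V w₁ has zero average, so [w] = w, and ∫|∇w|² = μ ∫ V[w]²
- μ m (c₁² c₂ + c₂² c₁) < μ ∫ V[w]², against the minimality of σ₁.

The count follows. Two domains with u ≥ 0 must overlap, and neither has a boundary point of the
other inside it, because there u would have an interior minimum and u' would vanish; so they
coincide. A domain with u < 0 must end at r = d: at an earlier end point u' > 0, and a positivity
interval disjoint from (d, 1) would start there. Hence two negative domains overlap next to r = d
and coincide. This leaves at most one domain of each kind. -/

noncomputable section

namespace MeanField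

variable {n : ℕ}

/-! ### Radial integrals and masses of balls -/

/-- The volume of the unit ball of `ℝⁿ`. -/
def ballVolume (n : ℕ) : ℝ := volume.real (Metric.ball (0 : EuclideanSpace ℝ (Fin n)) 1)

lemma ballVolume_pos (n : ℕ) : 0 < ballVolume n :=
  ENNReal.toReal_pos (Metric.measure_ball_pos _ _ one_pos).ne' measure_ball_lt_top.ne

lemma isFiniteMeasure_unitBall : IsFiniteMeasure (volume.restrict (unitBall n)) :=
  ⟨by simpa [unitBall] using measure_ball_lt_top⟩

lemma measurableSet_unitBall : MeasurableSet (unitBall n) := Metric.isOpen_ball.measurableSet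

lemma mem_unitBall {x : EuclideanSpace ℝ (Fin n)} : x ∈ unitBall n ↔ ‖x‖ < 1 := by
  simp [unitBall]

lemma setIntegral_unitBall_norm (hn : 2 ≤ n) (f : ℝ → ℝ) :
    ∫ x in unitBall n, f ‖x‖ = n * ballVolume n * ∫ r in (0 : ℝ)..1, r ^ (n - 1) * f r := by
  have : Nonempty (Fin n) := ⟨⟨0, by omega⟩⟩
  rw [← integral_indicator measurableSet_unitBall]
  have h1 : (unitBall n).indicator (fun x => f ‖x‖)
      = fun x : EuclideanSpace ℝ (Fin n) => (Iio (1 : ℝ)).indicator f ‖x‖ := by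
    ext x
    simp [indicator, mem_unitBall]
  rw [h1, integral_fun_norm_addHaar volume, intervalIntegral.integral_of_le zero_le_one,
    ← integral_Ioc_eq_integral_Ioo.symm, ← integral_indicator measurableSet_Ioi,
    ← integral_indicator measurableSet_Ioo]
  simp only [finrank_euclideanSpace_fin, nsmul_eq_mul, smul_eq_mul, ballVolume, mul_assoc]
  congr 3
  ext r
  simp only [indicator, mem_Ioi, mem_Iio, mem_Ioo]
  by_cases h0 : 0 < r <;> by_cases h2 : r < 1 <;> simp [h0, h2]

/-- In polar coordinates the weight r^(n-1) is at most 1 on (0, 1). Through this bound, `L²` norms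
on the interval control `L²` norms of radial functions on the ball. -/
lemma map_norm_le (hn : 2 ≤ n) :
    (volume.restrict (unitBall n)).map (fun x => ‖x‖)
      ≤ ENNReal.ofReal (n * ballVolume n) • volume.restrict (Ioo (0 : ℝ) 1) := by
  have := isFiniteMeasure_unitBall (n := n)
  refine Measure.le_iff.2 fun s hs => ?_
  have hm : Measurable (fun x : EuclideanSpace ℝ (Fin n) => ‖x‖) := measurable_norm
  rw [Measure.map_apply hm hs, Measure.smul_apply, smul_eq_mul]
  have hC : 0 ≤ n * ballVolume n := by have := ballVolume_pos n; positivity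
  rw [← ENNReal.ofReal_toReal (measure_ne_top (volume.restrict (unitBall n)) _),
    ← ENNReal.ofReal_toReal (measure_ne_top (volume.restrict (Ioo (0 : ℝ) 1)) s),
    ← ENNReal.ofReal_mul hC]
  refine ENNReal.ofReal_le_ofReal ?_
  have h1 := setIntegral_unitBall_norm hn (s.indicator 1)
  have h2 : ∫ x in unitBall n, s.indicator (1 : ℝ → ℝ) ‖x‖
      = (volume.restrict (unitBall n)).real ((fun x => ‖x‖) ⁻¹' s) := by
    rw [← integral_indicator_one (hm hs)]
    rfl
  change (volume.restrict (unitBall n)).real _ ≤ _ * (volume.restrict (Ioo (0 : ℝ) 1)).real s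
  rw [← h2, h1]
  refine mul_le_mul_of_nonneg_left ?_ hC
  rw [← integral_indicator_one hs, intervalIntegral.integral_of_le zero_le_one,
    integral_Ioc_eq_integral_Ioo]
  have hi : Integrable (s.indicator (1 : ℝ → ℝ)) (volume.restrict (Ioo (0 : ℝ) 1)) :=
    (integrable_const (1 : ℝ)).indicator hs
  refine integral_mono_of_nonneg ?_ hi ?_
  · refine (ae_restrict_iff' measurableSet_Ioo).2 (Eventually.of_forall fun r hr => ?_)
    exact mul_nonneg (pow_nonneg hr.1.le _) (indicator_nonneg (fun _ _ => zero_le_one) _)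
  · refine (ae_restrict_iff' measurableSet_Ioo).2 (Eventually.of_forall fun r hr => ?_)
    exact mul_le_of_le_one_left (indicator_nonneg (fun _ _ => zero_le_one) _)
      (pow_le_one₀ hr.1.le hr.2.le)

lemma volume_real_ball (hn : 2 ≤ n) {r : ℝ} (hr : 0 ≤ r) :
    volume.real (Metric.ball (0 : EuclideanSpace ℝ (Fin n)) r) = r ^ n * ballVolume n := by
  have : Nonempty (Fin n) := ⟨⟨0, by omega⟩⟩
  rw [measureReal_def, Measure.addHaar_ball volume (0 : EuclideanSpace ℝ (Fin n)) hr,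
    ENNReal.toReal_mul, finrank_euclideanSpace_fin, ENNReal.toReal_ofReal (by positivity)]
  rfl

lemma volume_real_shell (hn : 2 ≤ n) {r s : ℝ} (hr : 0 ≤ r) (h : r ≤ s) :
    volume.real (Metric.ball (0 : EuclideanSpace ℝ (Fin n)) s \ Metric.ball 0 r)
      = (s ^ n - r ^ n) * ballVolume n := by
  rw [measureReal_sdiff (Metric.ball_subset_ball h) Metric.isOpen_ball.measurableSet
    measure_ball_lt_top.ne, volume_real_ball hn hr, volume_real_ball hn (hr.trans h), sub_mul]

/-- The integral of `W` over the ball of radius `r`. -/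
def ballMass (W : EuclideanSpace ℝ (Fin n) → ℝ) (r : ℝ) : ℝ := ∫ x in Metric.ball 0 r, W x

lemma ballMass_of_nonpos (W : EuclideanSpace ℝ (Fin n) → ℝ) {r : ℝ} (hr : r ≤ 0) :
    ballMass W r = 0 := by
  simp [ballMass, Metric.ball_eq_empty.2 hr]

lemma ballMass_sub {W : EuclideanSpace ℝ (Fin n) → ℝ} (hW : Integrable W) {r s : ℝ} (h : r ≤ s) :
    ballMass W s - ballMass W r = ∫ x in Metric.ball 0 s \ Metric.ball 0 r, W x := by
  rw [ballMass, ballMass, setIntegral_sdiff Metric.isOpen_ball.measurableSet hW.integrableOn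
    (Metric.ball_subset_ball h)]

lemma abs_ballMass_sub_le (hn : 2 ≤ n) {W : EuclideanSpace ℝ (Fin n) → ℝ} (hW : Integrable W)
    {C r s : ℝ} (hr : 0 ≤ r) (h : r ≤ s) (hC : ∀ x, r ≤ ‖x‖ → ‖x‖ < s → |W x| ≤ C) :
    |ballMass W s - ballMass W r| ≤ C * ((s ^ n - r ^ n) * ballVolume n) := by
  rw [ballMass_sub hW h]
  rw [← volume_real_shell hn hr h, ← Real.norm_eq_abs]
  refine norm_setIntegral_le_of_norm_le_const ?_ fun x hx => ?_
  · exact (measure_mono sdiff_subset).trans_lt measure_ball_lt_top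
  · simp only [Set.mem_sdiff, mem_ball_zero_iff, not_lt] at hx
    exact hC x hx.2 hx.1

lemma continuous_ballMass (hn : 2 ≤ n) {W : EuclideanSpace ℝ (Fin n) → ℝ} (hW : Integrable W)
    {C : ℝ} (hC : ∀ x, |W x| ≤ C) : Continuous (ballMass W) := by
  -- Balls of nonpositive radius are empty, so radii may be replaced by their positive parts and the
  -- shell estimate applies on the whole line.
  have key : ∀ r, ballMass W r = ballMass W (max r 0) := fun r => by
    rcases le_total r 0 with h | h
    · rw [max_eq_right h, ballMass_of_nonpos W h, ballMass_of_nonpos W le_rfl]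
    · rw [max_eq_left h]
  rw [continuous_iff_continuousAt]
  intro r
  have hlim : Tendsto (fun s : ℝ => C * (|max s 0 ^ n - max r 0 ^ n| * ballVolume n)) (𝓝 r)
      (𝓝 0) := by
    have : Continuous fun s : ℝ => C * (|max s 0 ^ n - max r 0 ^ n| * ballVolume n) := by
      fun_prop
    simpa using this.tendsto r
  rw [ContinuousAt, tendsto_iff_dist_tendsto_zero]
  refine squeeze_zero (fun _ => dist_nonneg) (fun s => ?_) hlim
  rw [key s, key r, Real.dist_eq]
  rcases le_total (max s 0) (max r 0) with h | h
  · rw [abs_sub_comm, abs_sub_comm (max s 0 ^ n),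
      abs_of_nonneg (sub_nonneg.2 (pow_le_pow_left₀ (le_max_right _ _) h n))]
    exact abs_ballMass_sub_le hn hW (le_max_right _ _) h fun x _ _ => hC x
  · rw [abs_of_nonneg (sub_nonneg.2 (pow_le_pow_left₀ (le_max_right _ _) h n))]
    exact abs_ballMass_sub_le hn hW (le_max_right _ _) h fun x _ _ => hC x

lemma abs_ballMass_le (hn : 2 ≤ n) {W : EuclideanSpace ℝ (Fin n) → ℝ} (hW : Integrable W)
    {C : ℝ} (hC : ∀ x, |W x| ≤ C) {r : ℝ} (hr : 0 ≤ r) :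
    |ballMass W r| ≤ C * ballVolume n * r ^ n := by
  have := abs_ballMass_sub_le hn hW le_rfl hr fun x _ _ => hC x
  rw [ballMass_of_nonpos W le_rfl, sub_zero, zero_pow (by omega), sub_zero] at this
  linarith [this]

/-- The quotient `M(r) / r ^ (n - 1)`, where `M` is the integral of `W` over balls, is a
continuous function of `r` on the whole line. -/
lemma continuous_ballMass_div (hn : 2 ≤ n) {W : EuclideanSpace ℝ (Fin n) → ℝ}
    (hW : Integrable W) {C : ℝ} (hC : ∀ x, |W x| ≤ C) :
    Continuous fun r : ℝ => ballMass W r / r ^ (n - 1) := by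
  rw [continuous_iff_continuousAt]
  intro r
  rcases eq_or_ne r 0 with rfl | hr
  -- At the origin the quotient is `0 / 0`, with default value `0`. This is also the limit: the mass
  -- is `O(r ^ n)` from the right and zero from the left.
  · have hz : ballMass W 0 / (0 : ℝ) ^ (n - 1) = 0 := by simp [ballMass_of_nonpos W le_rfl]
    rw [ContinuousAt, hz]
    have hlim : Tendsto (fun r : ℝ => C * ballVolume n * |r|) (𝓝 0) (𝓝 0) := by
      have : Continuous fun r : ℝ => C * ballVolume n * |r| := by fun_prop
      simpa using this.tendsto 0
    refine squeeze_zero_norm (fun r => ?_) hlim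
    have hC0 : 0 ≤ C := (abs_nonneg _).trans (hC 0)
    have := ballVolume_pos n
    rcases le_or_gt r 0 with h | h
    · rw [ballMass_of_nonpos W h, zero_div, norm_zero]
      positivity
    · rw [norm_div, Real.norm_eq_abs, Real.norm_of_nonneg (pow_nonneg h.le _),
        div_le_iff₀ (by positivity), abs_of_pos h, mul_assoc (C * ballVolume n), ← pow_succ',
        Nat.sub_add_cancel (by omega)]
      exact abs_ballMass_le hn hW hC h.le
  · exact (continuous_ballMass hn hW hC).continuousAt.div (by fun_prop) (pow_ne_zero _ hr)

/-! ### Radial primitives and radial test functions -/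

/-- The primitive of `P` vanishing at `1`. -/
def primitive (P : ℝ → ℝ) (r : ℝ) : ℝ := -∫ s in r..1, P s

/-- Fubini's theorem for the product of `W` with a radial primitive. -/
lemma setIntegral_mul_primitive {W : EuclideanSpace ℝ (Fin n) → ℝ} (hW : Integrable W)
    {P : ℝ → ℝ} (hP : Measurable P) {C : ℝ} (hC : ∀ r, |P r| ≤ C) :
    ∫ x in unitBall n, W x * primitive P ‖x‖ = -∫ r in (0 : ℝ)..1, P r * ballMass W r := by
  -- The function W(x) P(r) is integrated over the region |x| < r ≤ 1. Integrating in r first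
  -- produces the primitive, integrating in x first produces the mass of the ball of radius r.
  have hmeas : MeasurableSet {p : EuclideanSpace ℝ (Fin n) × ℝ | ‖p.1‖ < p.2} :=
    measurableSet_lt (by fun_prop) (by fun_prop)
  have hint : Integrable (fun p : EuclideanSpace ℝ (Fin n) × ℝ =>
      {p : EuclideanSpace ℝ (Fin n) × ℝ | ‖p.1‖ < p.2}.indicator (fun p => W p.1 * P p.2) p)
      ((volume.restrict (unitBall n)).prod (volume.restrict (Ioc (0 : ℝ) 1))) := by
    refine Integrable.indicator ?_ hmeas
    exact Integrable.mul_prod hW.restrict (Integrable.of_bound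
      hP.aestronglyMeasurable C (Eventually.of_forall hC))
  have hswap := integral_integral_swap (f := fun x r =>
    {p : EuclideanSpace ℝ (Fin n) × ℝ | ‖p.1‖ < p.2}.indicator (fun p => W p.1 * P p.2) (x, r)) hint
  have hL : ∀ x ∈ unitBall n, (∫ r in Ioc (0 : ℝ) 1,
      {p : EuclideanSpace ℝ (Fin n) × ℝ | ‖p.1‖ < p.2}.indicator (fun p => W p.1 * P p.2) (x, r))
      = -(W x * primitive P ‖x‖) := by
    intro x hx
    rw [primitive, intervalIntegral.integral_of_le (mem_unitBall.1 hx).le, mul_neg, neg_neg,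
      ← integral_const_mul, ← integral_indicator measurableSet_Ioc,
      ← integral_indicator measurableSet_Ioc]
    refine integral_congr_ae (Eventually.of_forall fun r => ?_)
    have h0 := norm_nonneg x
    simp only [indicator, mem_Ioc, mem_ofPred_eq]
    split_ifs <;> first | rfl | (exfalso; grind)
  have hR : ∀ r ∈ Ioc (0 : ℝ) 1, (∫ x in unitBall n,
      {p : EuclideanSpace ℝ (Fin n) × ℝ | ‖p.1‖ < p.2}.indicator (fun p => W p.1 * P p.2) (x, r))
      = P r * ballMass W r := by
    intro r hr
    rw [ballMass, ← integral_const_mul, ← integral_indicator measurableSet_unitBall,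
      ← integral_indicator Metric.isOpen_ball.measurableSet]
    refine integral_congr_ae (Eventually.of_forall fun x => ?_)
    simp only [indicator, mem_unitBall, mem_ofPred_eq, mem_ball_zero_iff]
    by_cases h : ‖x‖ < r
    · simp [h, h.trans_le hr.2, mul_comm]
    · simp [h]
  rw [setIntegral_congr_fun measurableSet_unitBall hL,
    setIntegral_congr_fun measurableSet_Ioc hR, integral_neg] at hswap
  rw [intervalIntegral.integral_of_le zero_le_one]
  linarith

/-- The margins at both ends make the primitive of `q` constant near 0 and zero near 1, which is
what a smooth, compactly supported radial extension needs. -/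
lemma exists_Icc_of_tsupport_subset {q : ℝ → ℝ} (hs : tsupport q ⊆ Ioo 0 1) :
    ∃ a b : ℝ, 0 < a ∧ a < b ∧ b < 1 ∧ tsupport q ⊆ Icc a b := by
  have hK : IsCompact (tsupport q) :=
    isCompact_Icc.of_isClosed_subset (isClosed_tsupport q) (hs.trans Ioo_subset_Icc_self)
  rcases (tsupport q).eq_empty_or_nonempty with h | h
  · exact ⟨1 / 3, 1 / 2, by norm_num, by norm_num, by norm_num, by simp [h]⟩
  · obtain ⟨a, ha, ha'⟩ := hK.exists_isLeast h
    obtain ⟨b, hb, hb'⟩ := hK.exists_isGreatest h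
    have h1 := hs ha
    have h2 := hs hb
    refine ⟨a / 2, (b + 1) / 2, by linarith [h1.1], by linarith [h1.1, ha' hb],
      by linarith [h2.2], fun x hx => ⟨by linarith [ha' hx, h1.1], by linarith [hb' hx, h2.2]⟩⟩

lemma hasDerivAt_primitive {P : ℝ → ℝ} (hP : Continuous P) (r : ℝ) :
    HasDerivAt (primitive P) (P r) r := by
  have := (intervalIntegral.integral_hasDerivAt_left (hP.intervalIntegrable r 1)
    (hP.stronglyMeasurableAtFilter _ _) hP.continuousAt).neg
  rwa [neg_neg] at this

lemma contDiff_primitive {P : ℝ → ℝ} (hP : ContDiff ℝ ∞ P) : ContDiff ℝ ∞ (primitive P) := by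
  rw [contDiff_infty_iff_deriv]
  refine ⟨fun r => (hasDerivAt_primitive hP.continuous r).differentiableAt, ?_⟩
  rwa [show deriv (primitive P) = P from
    funext fun r => (hasDerivAt_primitive hP.continuous r).deriv]

lemma primitive_one (P : ℝ → ℝ) : primitive P 1 = 0 := by simp [primitive]

lemma hasGradientAt_norm {x : EuclideanSpace ℝ (Fin n)} (hx : x ≠ 0) :
    HasGradientAt (fun x : EuclideanSpace ℝ (Fin n) => ‖x‖) (‖x‖⁻¹ • x) x := by
  rw [hasGradientAt_iff_hasFDerivAt]
  have h := ((hasStrictFDerivAt_norm_sq x).hasFDerivAt).sqrt (by simpa using hx)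
  simp only [Real.sqrt_sq (norm_nonneg _)] at h
  convert! h using 1
  ext y
  simp only [InnerProductSpace.toDual_apply_apply, inner_smul_left, smul_apply,
    innerSL_apply_apply, smul_eq_mul, nsmul_eq_mul, conj_trivial]
  have := norm_ne_zero_iff.2 hx
  push_cast
  field_simp

/-- A smooth profile that is constant near the origin gives a smooth radial function. -/
lemma contDiff_radial {h : ℝ → ℝ} (hh : ContDiff ℝ ∞ h) {δ : ℝ} (hδ : 0 < δ)
    (h0 : ∀ r, |r| < δ → h r = h 0) :
    ContDiff ℝ ∞ (fun x : EuclideanSpace ℝ (Fin n) => h ‖x‖) := by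
  rw [contDiff_iff_contDiffAt]
  intro x
  rcases eq_or_ne x 0 with rfl | hx
  · refine (contDiffAt_const (c := h 0)).congr_of_eventuallyEq ?_
    filter_upwards [Metric.ball_mem_nhds _ hδ] with y hy
    exact h0 _ (by simpa using hy)
  · exact hh.contDiffAt.comp x (contDiffAt_norm ℝ hx)

lemma hasGradientAt_radial {h : ℝ → ℝ} (hh : Differentiable ℝ h) {δ : ℝ} (hδ : 0 < δ)
    (h0 : ∀ r, |r| < δ → h r = h 0) (x : EuclideanSpace ℝ (Fin n)) :
    HasGradientAt (fun x : EuclideanSpace ℝ (Fin n) => h ‖x‖)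
      (deriv h ‖x‖ • (‖x‖⁻¹ • x)) x := by
  rcases eq_or_ne x 0 with rfl | hx
  · rw [smul_zero, smul_zero]
    have : HasGradientAt (fun _ : EuclideanSpace ℝ (Fin n) => h 0) 0 0 := hasGradientAt_const 0 (h 0)
    refine this.congr_of_eventuallyEq ?_
    filter_upwards [Metric.ball_mem_nhds _ hδ] with y hy
    exact h0 _ (by simpa using hy)
  · have h1 := hasGradientAt_iff_hasFDerivAt.1 (hasGradientAt_norm hx)
    have h2 := (hh ‖x‖).hasDerivAt.comp_hasFDerivAt x h1
    rw [hasGradientAt_iff_hasFDerivAt, map_smul]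
    exact h2

lemma eq_zero_of_tsupport_subset {q : ℝ → ℝ} {s : Set ℝ} (hs : tsupport q ⊆ s) {r : ℝ}
    (hr : r ∉ s) : q r = 0 :=
  image_eq_zero_of_notMem_tsupport fun h => hr (hs h)

lemma primitive_eq_of_tsupport {q : ℝ → ℝ} (hc : Continuous q) {a b : ℝ}
    (hs : tsupport q ⊆ Icc a b) {r s : ℝ} (hrs : r ≤ s) (h : s ≤ a ∨ b ≤ r) :
    primitive q r = primitive q s := by
  have h1 : primitive q r = -(∫ t in r..s, q t) + primitive q s := by
    rw [primitive, primitive, ← intervalIntegral.integral_add_adjacent_intervals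
      (hc.intervalIntegrable r s) (hc.intervalIntegrable s 1)]
    ring
  have h2 : ∫ t in r..s, q t = 0 := by
    rw [intervalIntegral.integral_of_le hrs, integral_Ioc_eq_integral_Ioo]
    refine setIntegral_eq_zero_of_forall_eq_zero fun t ht => ?_
    refine eq_zero_of_tsupport_subset hs fun h' => ?_
    rcases h with h | h
    · exact absurd h'.1 (by linarith [ht.2])
    · exact absurd h'.2 (by linarith [ht.1])
  rw [h1, h2, neg_zero, zero_add]

/-- The primitive is constant near 0, where the norm is not smooth, and vanishes beyond the support
of `q`. These are the radial test functions with prescribed slope that reduce the weak equation to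
one variable. -/
lemma isTestFunction_primitive {q : ℝ → ℝ} (hq : ContDiff ℝ ∞ q) (hs : tsupport q ⊆ Ioo 0 1) :
    IsTestFunction (unitBall n) (fun x => primitive q ‖x‖) ∧
    ∀ x : EuclideanSpace ℝ (Fin n),
      gradient (fun x => primitive q ‖x‖) x = q ‖x‖ • (‖x‖⁻¹ • x) := by
  obtain ⟨a, b, ha, hab, hb, hsub⟩ := exists_Icc_of_tsupport_subset hs
  have hconst : ∀ r, |r| < a → primitive q r = primitive q 0 := fun r hr => by
    rw [abs_lt] at hr
    rcases le_total r 0 with h | h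
    · exact primitive_eq_of_tsupport hq.continuous hsub h (Or.inl ha.le)
    · exact (primitive_eq_of_tsupport hq.continuous hsub h (Or.inl hr.2.le)).symm
  have hsupp : tsupport (fun x : EuclideanSpace ℝ (Fin n) => primitive q ‖x‖)
      ⊆ Metric.closedBall 0 b := by
    refine closure_minimal (fun x hx => ?_) Metric.isClosed_closedBall
    by_contra hxb
    rw [mem_closedBall_zero_iff, not_le] at hxb
    refine hx ?_
    change primitive q ‖x‖ = 0
    rcases le_total ‖x‖ 1 with h | h
    · rw [primitive_eq_of_tsupport hq.continuous hsub h (Or.inr hxb.le), primitive_one]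
    · rw [← primitive_eq_of_tsupport hq.continuous hsub h (Or.inr hb.le), primitive_one]
  refine ⟨⟨contDiff_radial (contDiff_primitive hq) ha hconst, ?_, ?_⟩, fun x => ?_⟩
  · exact (isCompact_closedBall _ _).of_isClosed_subset (isClosed_tsupport _) hsupp
  · exact hsupp.trans (Metric.closedBall_subset_ball hb)
  · have := (hasGradientAt_radial ((contDiff_primitive hq).differentiable (by simp)) ha hconst
      x).gradient
    rwa [(hasDerivAt_primitive hq.continuous _).deriv] at this

/-! ### Integration by parts against radial fields -/

/-- Convergence of integrals from `L²` convergence of a dominating sequence. -/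
lemma tendsto_integral_of_eLpNorm {X H : Type*} [MeasurableSpace X] [NormedAddCommGroup H]
    {ν : Measure X} [IsFiniteMeasure ν] {F : ℕ → X → H} {a : ℕ → X → ℝ} {b : X → ℝ} {C : ℝ}
    (hF : ∀ k, AEStronglyMeasurable (F k) ν)
    (hlim : Tendsto (fun k => eLpNorm (F k) 2 ν) atTop (𝓝 0))
    (ha : ∀ k, Integrable (a k) ν) (hb : Integrable b ν)
    (hab : ∀ k, ∀ᵐ x ∂ν, ‖a k x - b x‖ ≤ C * ‖F k x‖) :
    Tendsto (fun k => ∫ x, a k x ∂ν) atTop (𝓝 (∫ x, b x ∂ν)) := by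
  refine tendsto_integral_of_L1' b hb.aestronglyMeasurable (Eventually.of_forall ha) ?_
  have hle : ∀ k, eLpNorm (a k - b) 1 ν
      ≤ ENNReal.ofReal C * (eLpNorm (F k) 2 ν * ν univ ^ (1 / (1 : ENNReal).toReal
        - 1 / (2 : ENNReal).toReal)) := fun k =>
    (eLpNorm_le_mul_eLpNorm_of_ae_le_mul (hab k) 1).trans (by
      gcongr
      exact eLpNorm_le_eLpNorm_mul_rpow_measure_univ (by norm_num) (hF k))
  have h0 : Tendsto (fun k => ENNReal.ofReal C * (eLpNorm (F k) 2 ν *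
      ν univ ^ (1 / (1 : ENNReal).toReal - 1 / (2 : ENNReal).toReal))) atTop (𝓝 0) := by
    have hfin : ν univ ^ (1 / (1 : ENNReal).toReal - 1 / (2 : ENNReal).toReal) ≠ ⊤ :=
      ENNReal.rpow_ne_top_of_nonneg (by norm_num) (measure_ne_top _ _)
    simpa using ENNReal.Tendsto.const_mul (ENNReal.Tendsto.mul_const hlim (Or.inr hfin))
      (Or.inr ENNReal.ofReal_ne_top)
  exact tendsto_of_tendsto_of_tendsto_of_le_of_le tendsto_const_nhds h0 (fun _ => zero_le) hle

/-- One coordinate of the integration by parts against the field A(x) x; the integrability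
statements are recorded so that the coordinates can be summed. -/
lemma integral_mul_apply_mul_fderiv {η A : EuclideanSpace ℝ (Fin n) → ℝ} (hη : ContDiff ℝ ∞ η)
    (hc : HasCompactSupport η) (hA : ContDiff ℝ 1 A) (i : Fin n) :
    Integrable (fun x => A x * x i * fderiv ℝ η x (EuclideanSpace.single i 1)) ∧
    Integrable (fun x => η x * (x i * fderiv ℝ A x (EuclideanSpace.single i 1) + A x)) ∧
    ∫ x, A x * x i * fderiv ℝ η x (EuclideanSpace.single i 1)
      = -∫ x, η x * (x i * fderiv ℝ A x (EuclideanSpace.single i 1) + A x) := by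
  have hcoord : ∀ x, HasFDerivAt (fun x : EuclideanSpace ℝ (Fin n) => x i)
      (EuclideanSpace.proj i : EuclideanSpace ℝ (Fin n) →L[ℝ] ℝ) x := fun x =>
    (EuclideanSpace.proj i : EuclideanSpace ℝ (Fin n) →L[ℝ] ℝ).hasFDerivAt
  have hdA : Differentiable ℝ A := hA.differentiable one_ne_zero
  have hder : ∀ x, fderiv ℝ (fun x => A x * x i) x (EuclideanSpace.single i 1)
      = x i * fderiv ℝ A x (EuclideanSpace.single i 1) + A x := fun x => by
    rw [((hdA x).hasFDerivAt.fun_mul (hcoord x)).fderiv]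
    simp
    ring
  have hcη : Continuous η := hη.continuous
  have hcA : Continuous A := hA.continuous
  have hc1 : Continuous fun x => fderiv ℝ η x (EuclideanSpace.single i 1) :=
    (hη.continuous_fderiv (by simp)).clm_apply continuous_const
  have hc2 : Continuous fun x => fderiv ℝ A x (EuclideanSpace.single i 1) :=
    (hA.continuous_fderiv one_ne_zero).clm_apply continuous_const
  have hcx : Continuous fun x : EuclideanSpace ℝ (Fin n) => x i := by fun_prop
  have hsup : HasCompactSupport fun x => fderiv ℝ η x (EuclideanSpace.single i 1) :=
    hc.fderiv_apply ℝ _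
  have i1 : Integrable (fun x => A x * x i * fderiv ℝ η x (EuclideanSpace.single i 1)) :=
    ((hcA.mul hcx).mul hc1).integrable_of_hasCompactSupport hsup.mul_left
  have i2 : Integrable (fun x => η x * (x i * fderiv ℝ A x (EuclideanSpace.single i 1) + A x)) :=
    (hcη.mul ((hcx.mul hc2).add hcA)).integrable_of_hasCompactSupport hc.mul_right
  refine ⟨i1, i2, ?_⟩
  rw [integral_mul_fderiv_eq_neg_fderiv_mul_of_integrable]
  · congr 1
    refine integral_congr_ae (Eventually.of_forall fun x => ?_)
    simp only [hder]
    ring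
  · refine i2.congr (Eventually.of_forall fun x => ?_)
    simp only [hder]
    ring
  · exact i1
  · exact ((hcA.mul hcx).mul hcη).integrable_of_hasCompactSupport hc.mul_left
  · exact fun x _ => (hdA x).mul (hcoord x).differentiableAt
  · exact fun x _ => hη.differentiable (by simp) x

lemma sum_apply_mul_clm (L : EuclideanSpace ℝ (Fin n) →L[ℝ] ℝ) (x : EuclideanSpace ℝ (Fin n)) :
    ∑ i, x i * L (EuclideanSpace.single i 1) = L x := by
  conv_rhs => rw [← (EuclideanSpace.basisFun (Fin n) ℝ).sum_repr x]
  simp [map_sum]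

lemma inner_gradient_left {η : EuclideanSpace ℝ (Fin n) → ℝ} (x y : EuclideanSpace ℝ (Fin n)) :
    inner ℝ (gradient η x) y = fderiv ℝ η x y := by
  simp [gradient]

/-- Integration by parts against the radial field `A(x) x`. -/
lemma integral_mul_inner_gradient {η A : EuclideanSpace ℝ (Fin n) → ℝ} (hη : ContDiff ℝ ∞ η)
    (hc : HasCompactSupport η) (hA : ContDiff ℝ 1 A) :
    ∫ x, A x * inner ℝ (gradient η x) x = -∫ x, η x * (n * A x + fderiv ℝ A x x) := by
  have h := fun i => integral_mul_apply_mul_fderiv hη hc hA i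
  have e1 : ∀ x, A x * inner ℝ (gradient η x) x
      = ∑ i, A x * x i * fderiv ℝ η x (EuclideanSpace.single i 1) := fun x => by
    rw [inner_gradient_left, ← sum_apply_mul_clm, Finset.mul_sum]
    simp_rw [mul_assoc]
  have e2 : ∀ x, η x * (n * A x + fderiv ℝ A x x)
      = ∑ i, η x * (x i * fderiv ℝ A x (EuclideanSpace.single i 1) + A x) := fun x => by
    rw [← Finset.mul_sum, Finset.sum_add_distrib, sum_apply_mul_clm]
    simp [add_comm]
  simp_rw [e1, e2]
  rw [integral_finsetSum _ fun i _ => (h i).1, integral_finsetSum _ fun i _ => (h i).2.1,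
    ← Finset.sum_neg_distrib]
  exact Finset.sum_congr rfl fun i _ => (h i).2.2

lemma gradient_eq_zero_of_notMem_tsupport {η : EuclideanSpace ℝ (Fin n) → ℝ}
    {x : EuclideanSpace ℝ (Fin n)} (hx : x ∉ tsupport η) : gradient η x = 0 := by
  have : fderiv ℝ η x = 0 := by
    by_contra h
    exact hx (support_fderiv_subset ℝ h)
  simp [gradient, this]

lemma continuous_gradient {η : EuclideanSpace ℝ (Fin n) → ℝ} (hη : ContDiff ℝ ∞ η) :
    Continuous (gradient η) :=
  (InnerProductSpace.toDual ℝ _).symm.continuous.comp (hη.continuous_fderiv (by simp))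

lemma setIntegral_mul_inner_gradient {η A : EuclideanSpace ℝ (Fin n) → ℝ}
    (hη : IsTestFunction (unitBall n) η) (hA : ContDiff ℝ 1 A) :
    ∫ x in unitBall n, A x * inner ℝ (gradient η x) x
      = -∫ x in unitBall n, η x * (n * A x + fderiv ℝ A x x) := by
  obtain ⟨h1, h2, h3⟩ := hη
  rw [setIntegral_eq_integral_of_forall_compl_eq_zero,
    setIntegral_eq_integral_of_forall_compl_eq_zero, integral_mul_inner_gradient h1 h2 hA]
  · intro x hx
    rw [image_eq_zero_of_notMem_tsupport fun h => hx (h3 h), zero_mul]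
  · intro x hx
    rw [gradient_eq_zero_of_notMem_tsupport fun h => hx (h3 h), inner_zero_left, mul_zero]

lemma exists_bound_on_unitBall {H : Type*} [SeminormedAddCommGroup H]
    {b : EuclideanSpace ℝ (Fin n) → H} (hb : ContinuousOn b (Metric.closedBall 0 1)) :
    ∃ C, ∀ x ∈ unitBall n, ‖b x‖ ≤ C := by
  obtain ⟨C, hC⟩ := (isCompact_closedBall (0 : EuclideanSpace ℝ (Fin n)) 1).exists_bound_of_continuousOn hb
  exact ⟨C, fun x hx => hC x (Metric.ball_subset_closedBall hx)⟩

/-- Integration by parts against `A(x) x` for functions in `H¹₀`. -/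
lemma MemH10.setIntegral_mul_inner {φ : EuclideanSpace ℝ (Fin n) → ℝ}
    {G : EuclideanSpace ℝ (Fin n) → EuclideanSpace ℝ (Fin n)} (h : MemH10 (unitBall n) φ G)
    {A : EuclideanSpace ℝ (Fin n) → ℝ} (hA : ContDiff ℝ 1 A) :
    ∫ x in unitBall n, A x * inner ℝ (G x) x
      = -∫ x in unitBall n, φ x * (n * A x + fderiv ℝ A x x) := by
  have hfin := isFiniteMeasure_unitBall (n := n)
  obtain ⟨hφ, hG, η, hη, l1, l2⟩ := h
  have hcA : Continuous A := hA.continuous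
  have hcb : Continuous fun x => n * A x + fderiv ℝ A x x :=
    (continuous_const.mul hcA).add ((hA.continuous_fderiv one_ne_zero).clm_apply continuous_id)
  obtain ⟨C1, hC1⟩ := exists_bound_on_unitBall (n := n) hcb.continuousOn
  obtain ⟨C2, hC2⟩ := exists_bound_on_unitBall (n := n) (b := fun x => A x • x)
    (hcA.smul continuous_id).continuousOn
  have hiη : ∀ k, Integrable (η k) (volume.restrict (unitBall n)) := fun k =>
    ((hη k).1.continuous.integrable_of_hasCompactSupport (hη k).2.1).restrict
  have hiφ := hφ.integrable (by norm_num)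
  have hiG := hG.integrable (by norm_num)
  have hmη : ∀ k, AEStronglyMeasurable (gradient (η k)) (volume.restrict (unitBall n)) := fun k =>
    (continuous_gradient (hη k).1).aestronglyMeasurable
  have hbdd : ∀ b : EuclideanSpace ℝ (Fin n) → EuclideanSpace ℝ (Fin n),
      Integrable b (volume.restrict (unitBall n)) →
      Integrable (fun x => A x * inner ℝ (b x) x) (volume.restrict (unitBall n)) := fun b hb => by
    refine Integrable.mono' (hb.norm.const_mul C2)
      (hcA.aestronglyMeasurable.mul (hb.aestronglyMeasurable.inner
        continuous_id.aestronglyMeasurable)) ?_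
    refine (ae_restrict_iff' measurableSet_unitBall).2 (Eventually.of_forall fun x hx => ?_)
    rw [← real_inner_smul_right, mul_comm]
    exact (norm_inner_le_norm _ _).trans (mul_le_mul_of_nonneg_left (hC2 x hx) (norm_nonneg _))
  have hgi : ∀ k, Integrable (gradient (η k)) (volume.restrict (unitBall n)) := fun k => by
    refine ((continuous_gradient (hη k).1).integrable_of_hasCompactSupport ?_).restrict
    refine (hη k).2.1.of_isClosed_subset (isClosed_tsupport _) (closure_minimal ?_
      (isClosed_tsupport _))
    intro x hx
    by_contra hx'
    exact hx (gradient_eq_zero_of_notMem_tsupport hx')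
  have t1 : Tendsto (fun k => ∫ x in unitBall n, A x * inner ℝ (gradient (η k) x) x) atTop
      (𝓝 (∫ x in unitBall n, A x * inner ℝ (G x) x)) := by
    refine tendsto_integral_of_eLpNorm (C := C2) (fun k => (hmη k).sub hG.aestronglyMeasurable) l2
      (fun k => hbdd _ (hgi k)) (hbdd _ hiG) fun k => ?_
    refine (ae_restrict_iff' measurableSet_unitBall).2 (Eventually.of_forall fun x hx => ?_)
    rw [← mul_sub, ← inner_sub_left, ← real_inner_smul_right, mul_comm]
    exact (norm_inner_le_norm _ _).trans (mul_le_mul_of_nonneg_left (hC2 x hx) (norm_nonneg _))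
  have hbdd' : ∀ b : EuclideanSpace ℝ (Fin n) → ℝ,
      Integrable b (volume.restrict (unitBall n)) →
      Integrable (fun x => b x * (n * A x + fderiv ℝ A x x)) (volume.restrict (unitBall n)) :=
    fun b hb => by
      refine hb.mul_bdd hcb.aestronglyMeasurable (c := C1) ?_
      exact (ae_restrict_iff' measurableSet_unitBall).2 (Eventually.of_forall hC1)
  have t2 : Tendsto (fun k => ∫ x in unitBall n, η k x * (n * A x + fderiv ℝ A x x)) atTop
      (𝓝 (∫ x in unitBall n, φ x * (n * A x + fderiv ℝ A x x))) := by
    refine tendsto_integral_of_eLpNorm (C := C1)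
      (fun k => (hiη k).aestronglyMeasurable.sub hφ.aestronglyMeasurable) l1
      (fun k => hbdd' _ (hiη k)) (hbdd' _ hiφ) fun k => ?_
    refine (ae_restrict_iff' measurableSet_unitBall).2 (Eventually.of_forall fun x hx => ?_)
    rw [← sub_mul, norm_mul, mul_comm]
    exact mul_le_mul_of_nonneg_right (hC1 x hx) (norm_nonneg _)
  refine tendsto_nhds_unique t1 ?_
  simp_rw [fun k => setIntegral_mul_inner_gradient (hη k) hA]
  exact t2.neg

/-! ### Radial functions with bounded slope belong to H¹₀ -/

/-- A bounded function on `(0, 1)` is an `L²` limit of smooth functions supported in `(0, 1)`. -/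
lemma exists_contDiff_eLpNorm_sub_le {P : ℝ → ℝ} (hP : Measurable P) {C : ℝ}
    (hC : ∀ r, |P r| ≤ C) {ε : ℝ} (hε : 0 < ε) :
    ∃ Q : ℝ → ℝ, ContDiff ℝ ∞ Q ∧ tsupport Q ⊆ Ioo 0 1 ∧
      eLpNorm (Q - P) 2 (volume.restrict (Ioo 0 1)) ≤ ENNReal.ofReal ε := by
  have hC0 : 0 ≤ C := (abs_nonneg _).trans (hC 0)
  -- Cutting `P` off outside [δ, 1 - δ] changes it on a set of measure at most 2δ, hence by at most
  -- C √(2δ) in `L²`. The denominator contains `C + 1` because `C` may vanish; δ < 1/4 keeps the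
  -- radii of the cutoff below positive.
  obtain ⟨δ, hδ0, hδ1, hδ2⟩ : ∃ δ : ℝ, 0 < δ ∧ δ < 1 / 4 ∧ C * Real.sqrt (2 * δ) ≤ ε / 2 := by
    refine ⟨min (1 / 8) ((ε / (2 * (C + 1))) ^ 2 / 2), by positivity,
      (min_le_left _ _).trans_lt (by norm_num), ?_⟩
    have h1 : Real.sqrt (2 * min (1 / 8) ((ε / (2 * (C + 1))) ^ 2 / 2)) ≤ ε / (2 * (C + 1)) := by
      rw [Real.sqrt_le_left (by positivity)]
      linarith [min_le_right (1 / 8) ((ε / (2 * (C + 1))) ^ 2 / 2)]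
    calc _ ≤ (C + 1) * (ε / (2 * (C + 1))) := by gcongr; linarith
      _ = ε / 2 := by field_simp
  set K := Icc δ (1 - δ)
  set P₁ := K.indicator P
  have hm₁ : Measurable P₁ := hP.indicator measurableSet_Icc
  have e1 : eLpNorm (P₁ - P) 2 (volume.restrict (Ioo 0 1)) ≤ ENNReal.ofReal (ε / 2) := by
    have hS : MeasurableSet (Ioo (0 : ℝ) 1 \ K) := measurableSet_Ioo.diff measurableSet_Icc
    have hvol : volume (Ioo (0 : ℝ) 1 \ K) ≤ ENNReal.ofReal (2 * δ) := by
      have hsub : Ioo (0 : ℝ) 1 \ K ⊆ Ioo 0 δ ∪ Ioo (1 - δ) 1 := by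
        rintro r ⟨h1, h2⟩
        by_contra h
        simp only [mem_union, mem_Ioo, K, mem_Icc] at h h1 h2
        grind
      refine (measure_mono hsub).trans ((measure_union_le _ _).trans ?_)
      rw [Real.volume_Ioo, Real.volume_Ioo, ← ENNReal.ofReal_add (by linarith) (by linarith)]
      exact ENNReal.ofReal_le_ofReal (by linarith)
    calc eLpNorm (P₁ - P) 2 (volume.restrict (Ioo 0 1))
        ≤ eLpNorm ((Ioo (0 : ℝ) 1 \ K).indicator fun _ => C) 2 (volume.restrict (Ioo 0 1)) := by
          refine eLpNorm_mono_ae ((ae_restrict_iff' measurableSet_Ioo).2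
            (Eventually.of_forall fun r hr => ?_))
          by_cases h : r ∈ K
          · simp [P₁, h]
          · rw [indicator_of_mem (show r ∈ Ioo (0 : ℝ) 1 \ K from ⟨hr, h⟩),
              Real.norm_of_nonneg hC0]
            simpa [P₁, h] using hC r
      _ ≤ eLpNorm ((Ioo (0 : ℝ) 1 \ K).indicator fun _ => C) 2 volume :=
          eLpNorm_restrict_le _ _ _ _
      _ ≤ ENNReal.ofReal C * ENNReal.ofReal (2 * δ) ^ (1 / (2 : ENNReal).toReal) := by
          rw [eLpNorm_indicator_const hS (by norm_num) (by norm_num),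
            ← ofReal_norm, Real.norm_of_nonneg hC0]
          gcongr
      _ ≤ ENNReal.ofReal (ε / 2) := by
          rw [ENNReal.ofReal_rpow_of_pos (by linarith), ← ENNReal.ofReal_mul hC0]
          refine ENNReal.ofReal_le_ofReal ?_
          rwa [ENNReal.toReal_ofNat, ← Real.sqrt_eq_rpow]
  have hL : MemLp P₁ 2 volume := by
    rw [memLp_indicator_iff_restrict measurableSet_Icc]
    have : IsFiniteMeasure (volume.restrict K) := ⟨by simp [K]⟩
    exact MemLp.of_bound hP.aestronglyMeasurable C (Eventually.of_forall hC)
  obtain ⟨g, -, hg, hgP⟩ := hL.exist_eLpNorm_sub_le (by norm_num) (by norm_num) (half_pos hε)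
  -- The smooth approximation `g` need not be supported in (0, 1). The cutoff equals 1 on `K`, and
  -- off `K` the target `P₁` is zero, so multiplying by χ does not increase the error.
  let χ : ContDiffBump (1 / 2 : ℝ) := ⟨1 / 2 - δ, 1 / 2 - δ / 2, by linarith, by linarith⟩
  have hχ1 : ∀ r ∈ K, χ r = 1 := fun r hr => χ.one_of_mem_closedBall (by
    rw [Metric.mem_closedBall, Real.dist_eq, abs_le]
    change -(1 / 2 - δ) ≤ _ ∧ _ ≤ 1 / 2 - δ
    constructor <;> linarith [hr.1, hr.2])
  refine ⟨fun r => χ r * g r, χ.contDiff.mul hg, ?_, ?_⟩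
  · refine (tsupport_mul_subset_left (f := fun r => χ r)).trans ?_
    rw [χ.tsupport_eq]
    intro r hr
    rw [Metric.mem_closedBall, Real.dist_eq, abs_le] at hr
    simp only [χ] at hr
    constructor <;> linarith [hr.1, hr.2]
  · have hsplit : (fun r => χ r * g r) - P = ((fun r => χ r * g r) - P₁) + (P₁ - P) := by abel
    have hχm : Measurable fun r => χ r * g r := (χ.continuous.mul hg.continuous).measurable
    rw [hsplit, ← add_halves ε, ENNReal.ofReal_add (by linarith) (by linarith)]
    refine (eLpNorm_add_le (hχm.sub hm₁).aestronglyMeasurable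
      (hm₁.sub hP).aestronglyMeasurable (by norm_num)).trans (add_le_add ?_ e1)
    refine (eLpNorm_restrict_le _ _ _ _).trans ((eLpNorm_mono fun r => ?_).trans hgP)
    by_cases h : r ∈ K
    · simp [hχ1 r h, abs_sub_comm]
    · simp only [Pi.sub_apply, P₁, indicator_of_notMem h, sub_zero, zero_sub, norm_mul, norm_neg]
      exact mul_le_of_le_one_left (norm_nonneg _) (by
        rw [Real.norm_of_nonneg χ.nonneg]
        exact χ.le_one)

lemma norm_smul_inv_norm_smul_le (c : ℝ) (x : EuclideanSpace ℝ (Fin n)) :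
    ‖c • (‖x‖⁻¹ • x)‖ ≤ ‖c‖ := by
  rw [norm_smul, norm_smul, norm_inv, norm_norm]
  exact mul_le_of_le_one_right (norm_nonneg _) (inv_mul_le_one)

lemma eLpNorm_comp_norm_le (hn : 2 ≤ n) {g : ℝ → ℝ} (hg : Measurable g) :
    eLpNorm (fun x : EuclideanSpace ℝ (Fin n) => g ‖x‖) 2 (volume.restrict (unitBall n))
      ≤ ENNReal.ofReal (n * ballVolume n) ^ (1 / (2 : ENNReal)).toReal
        * eLpNorm g 2 (volume.restrict (Ioo 0 1)) := by
  have h1 := eLpNorm_map_measure (μ := volume.restrict (unitBall n)) (p := 2)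
    (f := fun x : EuclideanSpace ℝ (Fin n) => ‖x‖) (g := g) hg.aestronglyMeasurable
    measurable_norm.aemeasurable
  change eLpNorm (g ∘ fun x => ‖x‖) 2 _ ≤ _
  rw [← h1]
  refine (eLpNorm_mono_measure g (map_norm_le hn)).trans ?_
  rw [eLpNorm_smul_measure_of_ne_top (by norm_num), smul_eq_mul]

/-- Lebesgue measure on (0, 1) is a probability measure, so the `L¹` norm of Q - P is at most its
`L²` norm, and the `L¹` norm bounds the difference of the primitives uniformly. -/
lemma norm_primitive_sub_le {P Q : ℝ → ℝ} (hQ : Continuous Q) (hP : Measurable P) {C : ℝ}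
    (hC : ∀ r, |P r| ≤ C) {ε : ℝ} (hε : 0 ≤ ε)
    (hPQ : eLpNorm (Q - P) 2 (volume.restrict (Ioo 0 1)) ≤ ENNReal.ofReal ε)
    {r : ℝ} (h0 : 0 ≤ r) (h1 : r ≤ 1) : ‖primitive Q r - primitive P r‖ ≤ ε := by
  have hiP : ∀ a b : ℝ, IntervalIntegrable P volume a b := fun a b =>
    (intervalIntegrable_const (c := C)).mono_fun hP.aestronglyMeasurable
      (Eventually.of_forall fun r => (hC r).trans (le_abs_self C))
  have hi : IntervalIntegrable (Q - P) volume 0 1 :=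
    (hQ.intervalIntegrable 0 1).sub (hiP 0 1)
  have hI : IntegrableOn (Q - P) (Ioc 0 1) :=
    (intervalIntegrable_iff_integrableOn_Ioc_of_le zero_le_one).1 hi
  have e : primitive Q r - primitive P r = -∫ s in Ioc r 1, (Q - P) s := by
    rw [primitive, primitive, ← intervalIntegral.integral_of_le h1]
    simp only [Pi.sub_apply]
    rw [intervalIntegral.integral_sub (hQ.intervalIntegrable r 1) (hiP r 1)]
    ring
  rw [e, norm_neg]
  refine (norm_integral_le_integral_norm _).trans ?_
  refine (setIntegral_mono_set hI.norm (Eventually.of_forall fun _ => norm_nonneg _)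
    (Ioc_subset_Ioc_left h0).eventuallyLE).trans ?_
  rw [integral_Ioc_eq_integral_Ioo]
  have hfin : IsProbabilityMeasure (volume.restrict (Ioo (0 : ℝ) 1)) := ⟨by simp⟩
  rw [integral_norm_eq_lintegral_enorm (hQ.measurable.sub hP).aestronglyMeasurable,
    ← eLpNorm_one_eq_lintegral_enorm]
  refine ENNReal.toReal_le_of_le_ofReal hε (le_trans ?_ hPQ)
  exact eLpNorm_le_eLpNorm_of_exponent_le (by norm_num)
    (hQ.measurable.sub hP).aestronglyMeasurable

lemma continuous_primitive {P : ℝ → ℝ} (hP : Measurable P) {C : ℝ} (hC : ∀ r, |P r| ≤ C) :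
    Continuous (primitive P) := by
  have hiP : ∀ a b : ℝ, IntervalIntegrable P volume a b := fun a b =>
    (intervalIntegrable_const (c := C)).mono_fun hP.aestronglyMeasurable
      (Eventually.of_forall fun r => (hC r).trans (le_abs_self C))
  have h := intervalIntegral.continuous_primitive hiP 1
  refine h.congr fun r => ?_
  rw [primitive, intervalIntegral.integral_symm]

/-- The radial function whose profile is the primitive of a bounded function `P`, vanishing at `1`,
belongs to `H¹₀` of the unit ball. -/
lemma memH10_primitive (hn : 2 ≤ n) {P : ℝ → ℝ} (hP : Measurable P) {C : ℝ}
    (hC : ∀ r, |P r| ≤ C) :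
    MemH10 (unitBall n) (fun x => primitive P ‖x‖) (fun x => P ‖x‖ • (‖x‖⁻¹ • x)) := by
  have hfin := isFiniteMeasure_unitBall (n := n)
  have hmG : Measurable fun x : EuclideanSpace ℝ (Fin n) => P ‖x‖ • (‖x‖⁻¹ • x) := by fun_prop
  have hcw : Continuous fun x : EuclideanSpace ℝ (Fin n) => primitive P ‖x‖ :=
    (continuous_primitive hP hC).comp continuous_norm
  obtain ⟨C', hC'⟩ := exists_bound_on_unitBall (n := n) hcw.continuousOn
  have hε : ∀ k : ℕ, (0 : ℝ) < 1 / ((k : ℝ) + 1) := fun k => by positivity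
  have hlim : Tendsto (fun k : ℕ => ENNReal.ofReal (1 / ((k : ℝ) + 1))) atTop (𝓝 0) := by
    rw [← ENNReal.ofReal_zero]
    exact (ENNReal.continuous_ofReal.tendsto 0).comp tendsto_one_div_add_atTop_nhds_zero_nat
  -- The slope is approximated rather than the function: primitives of the `Q k` are test functions,
  -- they converge uniformly, and their gradients converge in `L²`.
  choose Q hQ hQs hQP using fun k : ℕ => exists_contDiff_eLpNorm_sub_le hP hC (hε k)
  refine ⟨?_, ?_, fun k x => primitive (Q k) ‖x‖, fun k => (isTestFunction_primitive (hQ k)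
    (hQs k)).1, ?_, ?_⟩
  · exact MemLp.of_bound hcw.aestronglyMeasurable C'
      ((ae_restrict_iff' measurableSet_unitBall).2 (Eventually.of_forall hC'))
  · exact MemLp.of_bound hmG.aestronglyMeasurable C
      (Eventually.of_forall fun x => (norm_smul_inv_norm_smul_le _ _).trans (hC _))
  · have hb : ∀ k, eLpNorm (fun x : EuclideanSpace ℝ (Fin n) => primitive (Q k) ‖x‖
        - primitive P ‖x‖) 2 (volume.restrict (unitBall n))
        ≤ (volume.restrict (unitBall n)) univ ^ (2 : ENNReal).toReal⁻¹
          * ENNReal.ofReal (1 / ((k : ℝ) + 1)) := fun k => by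
      refine eLpNorm_le_of_ae_bound ((ae_restrict_iff' measurableSet_unitBall).2
        (Eventually.of_forall fun x hx => ?_))
      exact norm_primitive_sub_le (hQ k).continuous hP hC (hε k).le (hQP k) (norm_nonneg x)
        (mem_unitBall.1 hx).le
    have h0 := ENNReal.Tendsto.const_mul hlim (a := (volume.restrict (unitBall n)) univ ^
      (2 : ENNReal).toReal⁻¹) (Or.inr (ENNReal.rpow_ne_top_of_nonneg (by norm_num)
        (measure_ne_top _ _)))
    rw [mul_zero] at h0
    exact tendsto_of_tendsto_of_tendsto_of_le_of_le tendsto_const_nhds h0 (fun _ => zero_le) hb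
  · have hb : ∀ k, eLpNorm (fun x : EuclideanSpace ℝ (Fin n) =>
        gradient (fun x => primitive (Q k) ‖x‖) x - P ‖x‖ • (‖x‖⁻¹ • x)) 2
        (volume.restrict (unitBall n))
        ≤ ENNReal.ofReal (n * ballVolume n) ^ (1 / (2 : ENNReal)).toReal
          * ENNReal.ofReal (1 / ((k : ℝ) + 1)) := fun k => by
      refine le_trans ?_ (mul_le_mul_right (hQP k) _)
      refine le_trans ?_ (eLpNorm_comp_norm_le hn ((hQ k).continuous.measurable.sub hP))
      refine eLpNorm_mono fun x => ?_
      rw [(isTestFunction_primitive (hQ k) (hQs k)).2 x, ← sub_smul]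
      exact norm_smul_inv_norm_smul_le _ _
    have h0 := ENNReal.Tendsto.const_mul hlim
      (a := ENNReal.ofReal (n * ballVolume n) ^ (1 / (2 : ENNReal)).toReal)
      (Or.inr (ENNReal.rpow_ne_top_of_nonneg (by norm_num) ENNReal.ofReal_ne_top))
    rw [mul_zero] at h0
    exact tendsto_of_tendsto_of_tendsto_of_le_of_le tendsto_const_nhds h0 (fun _ => zero_le) hb

/-! ### The ordinary differential equation of a radial weak solution -/

/-- The lemma of du Bois-Reymond on the unit interval. -/
lemma eq_const_of_integral_mul_deriv_eq_zero {Y : ℝ → ℝ} (hY : ContinuousOn Y (Icc 0 1))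
    (h : ∀ q : ℝ → ℝ, ContDiff ℝ ∞ q → tsupport q ⊆ Ioo 0 1 →
      ∫ r in (0 : ℝ)..1, Y r * deriv q r = 0) :
    ∀ r ∈ Icc (0 : ℝ) 1, Y r = Y 1 := by
  have hYi : ∀ θ : ℝ → ℝ, Continuous θ → IntervalIntegrable (fun r => Y r * θ r) volume 0 1 :=
    fun θ hθ => ((by rwa [uIcc_of_le zero_le_one] : ContinuousOn Y (uIcc 0 1)).mul
      hθ.continuousOn).intervalIntegrable
  let χ : ContDiffBump (1 / 2 : ℝ) := ⟨1 / 8, 1 / 4, by norm_num, by norm_num⟩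
  set θ₀ : ℝ → ℝ := χ.normed volume with hθ₀
  have hθ₀s : ContDiff ℝ ∞ θ₀ := χ.contDiff_normed
  have hθ₀t : tsupport θ₀ ⊆ Icc (1 / 4) (3 / 4) := by
    rw [hθ₀, χ.tsupport_normed_eq, Real.closedBall_eq_Icc]
    refine Icc_subset_Icc ?_ ?_ <;> norm_num [χ]
  have hint : ∀ θ : ℝ → ℝ, tsupport θ ⊆ Ioo 0 1 → ∀ f : ℝ → ℝ,
      ∫ r in (0 : ℝ)..1, f r * θ r = ∫ r, f r * θ r := fun θ hθ f => by
    rw [intervalIntegral.integral_of_le zero_le_one, integral_Ioc_eq_integral_Ioo,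
      setIntegral_eq_integral_of_forall_compl_eq_zero]
    intro r hr
    rw [eq_zero_of_tsupport_subset hθ hr, mul_zero]
  have hθ₀' : tsupport θ₀ ⊆ Ioo 0 1 := hθ₀t.trans fun r hr =>
    ⟨by linarith [hr.1], by linarith [hr.2]⟩
  have hone : ∫ r in (0 : ℝ)..1, θ₀ r = 1 := by
    have := hint θ₀ hθ₀' fun _ => 1
    simp only [one_mul] at this
    rw [this]
    exact χ.integral_normed
  set c := ∫ r in (0 : ℝ)..1, Y r * θ₀ r with hc
  have key : ∀ θ : ℝ → ℝ, ContDiff ℝ ∞ θ → tsupport θ ⊆ Ioo 0 1 →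
      ∫ r in (0 : ℝ)..1, (Y r - c) * θ r = 0 := by
    intro θ hθ hθt
    obtain ⟨a, b, ha, hab, hb, hsub⟩ := exists_Icc_of_tsupport_subset hθt
    set I := ∫ r in (0 : ℝ)..1, θ r with hI
    -- Subtracting the right multiple of the unit mass `θ₀` makes the integral zero, so the
    -- primitive of ρ is again supported inside (0, 1) and is admissible as `q`.
    set ρ : ℝ → ℝ := fun r => θ r - I * θ₀ r with hρ
    have hρs : ContDiff ℝ ∞ ρ := hθ.sub (contDiff_const.mul hθ₀s)
    have hρt : tsupport ρ ⊆ Icc (min a (1 / 4)) (max b (3 / 4)) := by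
      refine closure_minimal (fun r hr => ?_) isClosed_Icc
      by_contra hrn
      refine hr ?_
      have h1 : r ∉ Icc a b := fun h' => hrn (Icc_subset_Icc (min_le_left _ _) (le_max_left _ _) h')
      have h2 : r ∉ Icc (1 / 4 : ℝ) (3 / 4) := fun h' =>
        hrn (Icc_subset_Icc (min_le_right _ _) (le_max_right _ _) h')
      simp only [hρ]
      rw [eq_zero_of_tsupport_subset hsub h1, eq_zero_of_tsupport_subset hθ₀t h2]
      ring
    have hm0 : 0 < min a (1 / 4) := lt_min ha (by norm_num)
    have hm1 : max b (3 / 4) < 1 := max_lt hb (by norm_num)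
    have hzero : primitive ρ 0 = 0 := by
      simp only [primitive, hρ]
      rw [intervalIntegral.integral_sub (hθ.continuous.intervalIntegrable _ _)
        ((hθ₀s.continuous.intervalIntegrable _ _).const_mul I),
        intervalIntegral.integral_const_mul, hone]
      simp [hI]
    have hsupp : tsupport (primitive ρ) ⊆ Icc (min a (1 / 4)) (max b (3 / 4)) := by
      refine closure_minimal (fun r hr => ?_) isClosed_Icc
      by_contra hrn
      refine hr ?_
      rcases lt_or_ge r (min a (1 / 4)) with h1 | h1
      · rcases le_total r 0 with h0 | h0
        · rw [primitive_eq_of_tsupport hρs.continuous hρt h0 (Or.inl hm0.le), hzero]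
        · rw [← primitive_eq_of_tsupport hρs.continuous hρt h0 (Or.inl h1.le), hzero]
      · have h2 : max b (3 / 4) < r := by
          by_contra h2
          exact hrn ⟨h1, not_lt.1 h2⟩
        rcases le_total r 1 with h0 | h0
        · rw [primitive_eq_of_tsupport hρs.continuous hρt h0 (Or.inr h2.le), primitive_one]
        · rw [← primitive_eq_of_tsupport hρs.continuous hρt h0 (Or.inr hm1.le), primitive_one]
    have h0 := h (primitive ρ) (contDiff_primitive hρs)
      (hsupp.trans fun r hr => ⟨by linarith [hr.1], by linarith [hr.2]⟩)
    simp only [fun r => (hasDerivAt_primitive hρs.continuous r).deriv] at h0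
    have e1 : ∫ r in (0 : ℝ)..1, Y r * ρ r = (∫ r in (0 : ℝ)..1, Y r * θ r) - I * c := by
      rw [hc, ← intervalIntegral.integral_const_mul, ← intervalIntegral.integral_sub
        (hYi θ hθ.continuous) ((hYi θ₀ hθ₀s.continuous).const_mul I)]
      congr 1
      ext r
      simp only [hρ]
      ring
    have e2 : ∫ r in (0 : ℝ)..1, (Y r - c) * θ r = (∫ r in (0 : ℝ)..1, Y r * θ r) - c * I := by
      rw [hI, ← intervalIntegral.integral_const_mul, ← intervalIntegral.integral_sub
        (hYi θ hθ.continuous) ((hθ.continuous.intervalIntegrable _ _).const_mul c)]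
      congr 1
      ext r
      ring
    rw [e2]
    linarith
  have hloc : LocallyIntegrableOn (fun r => Y r - c) (Ioo 0 1) :=
    ((hY.mono Ioo_subset_Icc_self).sub continuousOn_const).locallyIntegrableOn measurableSet_Ioo
  have hae := isOpen_Ioo.ae_eq_zero_of_integral_contDiff_smul_eq_zero hloc fun θ hθ _ hθt => by
    have := key θ hθ hθt
    rw [hint θ hθt] at this
    simpa [mul_comm] using this
  have hae' : Y =ᵐ[volume.restrict (Icc 0 1)] fun _ => c := by
    rw [← Measure.restrict_congr_set Ioo_ae_eq_Icc]
    refine (ae_restrict_iff' measurableSet_Ioo).2 (hae.mono fun r hr hm => ?_)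
    linarith [hr hm]
  have heq := Measure.eqOn_Icc_of_ae_eq volume zero_ne_one hae' hY continuousOn_const
  intro r hr
  rw [heq hr, heq (right_mem_Icc.2 zero_le_one)]

lemma tsupport_mul_inv_pow_subset {q : ℝ → ℝ} {s : Set ℝ} (hs : tsupport q ⊆ s) (k : ℕ) :
    tsupport (fun r => q r * (r ^ k)⁻¹) ⊆ s :=
  (tsupport_mul_subset_left (f := q) (g := fun r => (r ^ k)⁻¹)).trans hs

/-- The singularity at 0 is harmless because `q` vanishes in a neighbourhood of it. -/
lemma contDiff_mul_inv_pow {q : ℝ → ℝ} (hq : ContDiff ℝ ∞ q) (hs : tsupport q ⊆ Ioo 0 1) (k : ℕ) :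
    ContDiff ℝ ∞ fun r => q r * (r ^ k)⁻¹ := by
  rw [contDiff_iff_contDiffAt]
  intro r
  rcases eq_or_ne r 0 with rfl | hr
  · have h0 : (0 : ℝ) ∉ tsupport q := fun h => lt_irrefl _ (hs h).1
    refine (contDiffAt_const (c := (0 : ℝ))).congr_of_eventuallyEq ?_
    filter_upwards [(isClosed_tsupport q).isOpen_compl.mem_nhds h0] with t ht
    rw [image_eq_zero_of_notMem_tsupport ht, zero_mul]
  · exact hq.contDiffAt.mul ((contDiffAt_id.pow k).inv (pow_ne_zero k hr))

/-- A radial weak solution of `-Δφ = μ W` has a continuously differentiable profile, whose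
derivative is `-μ M(r) / (n |B₁| r ^ (n - 1))`, where `M` is the integral of `W` over balls. -/
lemma radial_profile_eq (hn : 2 ≤ n) {u : ℝ → ℝ} (hu : ContinuousOn u (Icc 0 1))
    {G : EuclideanSpace ℝ (Fin n) → EuclideanSpace ℝ (Fin n)}
    (hG : MemH10 (unitBall n) (radialFun n u) G) {W : EuclideanSpace ℝ (Fin n) → ℝ}
    (hW : Integrable W) {C : ℝ} (hC : ∀ x, |W x| ≤ C) {μ : ℝ}
    (hweak : ∀ η, IsTestFunction (unitBall n) η →
      ∫ x in unitBall n, inner ℝ (G x) (gradient η x) = μ * ∫ x in unitBall n, W x * η x) :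
    ∀ r ∈ Icc (0 : ℝ) 1, u r = u 1 +
      primitive (fun r => -(μ / (n * ballVolume n)) * (ballMass W r / r ^ (n - 1))) r := by
  set κ := μ / (n * ballVolume n) with hκ
  set g : ℝ → ℝ := fun r => -κ * (ballMass W r / r ^ (n - 1)) with hg
  have hn0 : (0 : ℝ) < n := by positivity
  have hω := ballVolume_pos n
  have hgc : Continuous g := continuous_const.mul (continuous_ballMass_div hn hW hC)
  have hΓ := hasDerivAt_primitive hgc
  have hΓc : Continuous (primitive g) := continuous_iff_continuousAt.2 fun r => (hΓ r).continuousAt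
  have key := eq_const_of_integral_mul_deriv_eq_zero (Y := fun r => u r - primitive g r)
    (hu.sub hΓc.continuousOn) fun q hq hs => by
    have hq0 : q 0 = 0 := eq_zero_of_tsupport_subset hs (by simp)
    have hq1 : q 1 = 0 := eq_zero_of_tsupport_subset hs (by simp)
    have hdq : Differentiable ℝ q := hq.differentiable (by simp)
    have hcdq : Continuous (deriv q) := hq.continuous_deriv (by simp)
    -- The test function with slope Q = q / r^(n-1) has gradient p(|x|) x, where p = q / r^n. The
    -- divergence of this field, times r^(n-1), is exactly q'. The weak equation thus becomes ∫ u q'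
    -- = -∫ g q, and the right side equals the integral of q' against the primitive of `g`.
    set Q : ℝ → ℝ := fun r => q r * (r ^ (n - 1))⁻¹ with hQ
    set p : ℝ → ℝ := fun r => q r * (r ^ n)⁻¹ with hp
    have hQs : ContDiff ℝ ∞ Q := contDiff_mul_inv_pow hq hs _
    have hps : ContDiff ℝ ∞ p := contDiff_mul_inv_pow hq hs _
    have hQt : tsupport Q ⊆ Ioo 0 1 := tsupport_mul_inv_pow_subset hs _
    have hpt : tsupport p ⊆ Ioo 0 1 := tsupport_mul_inv_pow_subset hs _
    have hdp : Differentiable ℝ p := hps.differentiable (by simp)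
    obtain ⟨a, b, ha, hab, hb, hsub⟩ := exists_Icc_of_tsupport_subset hpt
    have hp0 : ∀ r, |r| < a → p r = p 0 := fun r hr => by
      rw [eq_zero_of_tsupport_subset hsub fun h => absurd h.1 (not_le.2 (abs_lt.1 hr).2),
        eq_zero_of_tsupport_subset hsub fun h => absurd h.1 (not_le.2 ha)]
    have hA : ContDiff ℝ 1 fun x : EuclideanSpace ℝ (Fin n) => p ‖x‖ :=
      (contDiff_radial hps ha hp0).of_le (by exact_mod_cast le_top)
    have hdA : ∀ x : EuclideanSpace ℝ (Fin n),
        fderiv ℝ (fun x : EuclideanSpace ℝ (Fin n) => p ‖x‖) x x = ‖x‖ * deriv p ‖x‖ := fun x => by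
      rw [← inner_gradient_left, (hasGradientAt_radial hdp ha hp0 x).gradient,
        real_inner_smul_left, real_inner_smul_left, real_inner_self_eq_norm_sq]
      rcases eq_or_ne ‖x‖ 0 with h | h
      · simp [h]
      · field_simp
    have hibp := hG.setIntegral_mul_inner hA
    simp only [hdA, radialFun] at hibp
    rw [setIntegral_unitBall_norm hn fun r => u r * (n * p r + r * deriv p r)] at hibp
    have hqp : q = fun r => r ^ n * p r := by
      ext r
      rcases eq_or_ne r 0 with rfl | hr
      · simp [hq0, show n ≠ 0 by omega]
      · simp only [hp]
        field_simp
    have hder : ∀ r, deriv q r = r ^ (n - 1) * (n * p r + r * deriv p r) := fun r => by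
      have h1 := ((hasDerivAt_pow n r).mul (hdp r).hasDerivAt).deriv
      have h2 : r ^ n = r ^ (n - 1) * r := by rw [← pow_succ, Nat.sub_add_cancel (by omega)]
      rw [hqp]
      refine h1.trans ?_
      rw [h2]
      ring
    obtain ⟨htest, hgrad⟩ := isTestFunction_primitive (n := n) hQs hQt
    have hw := hweak _ htest
    have e1 : ∀ x : EuclideanSpace ℝ (Fin n),
        inner ℝ (G x) (gradient (fun x => primitive Q ‖x‖) x) = p ‖x‖ * inner ℝ (G x) x :=
      fun x => by
        rw [hgrad, real_inner_smul_right, real_inner_smul_right, ← mul_assoc]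
        congr 1
        simp only [hQ, hp]
        rw [mul_assoc, ← mul_inv, ← pow_succ, Nat.sub_add_cancel (by omega)]
    obtain ⟨C', hC'⟩ := (isCompact_Icc (a := (0 : ℝ)) (b := 1)).exists_bound_of_continuousOn
      hQs.continuous.continuousOn
    have hQb : ∀ r, |Q r| ≤ C' := fun r => by
      by_cases h : r ∈ Ioo (0 : ℝ) 1
      · exact hC' r (Ioo_subset_Icc_self h)
      · rw [eq_zero_of_tsupport_subset hQt h, abs_zero]
        exact (norm_nonneg _).trans (hC' 0 (by simp))
    simp only [e1] at hw
    rw [hibp, setIntegral_mul_primitive hW hQs.continuous.measurable hQb] at hw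
    have e2 : ∫ r in (0 : ℝ)..1, r ^ (n - 1) * (u r * (n * p r + r * deriv p r))
        = ∫ r in (0 : ℝ)..1, u r * deriv q r := by
      congr 1
      ext r
      rw [hder]
      ring
    have e3 : μ * ∫ r in (0 : ℝ)..1, Q r * ballMass W r
        = -(n * ballVolume n) * ∫ r in (0 : ℝ)..1, g r * q r := by
      rw [← intervalIntegral.integral_const_mul, ← intervalIntegral.integral_const_mul]
      congr 1
      ext r
      simp only [hQ, hg, hκ]
      field_simp
    have e4 : ∫ r in (0 : ℝ)..1, primitive g r * deriv q r = -∫ r in (0 : ℝ)..1, g r * q r := by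
      rw [intervalIntegral.integral_mul_deriv_eq_deriv_mul (fun r _ => hΓ r)
        (fun r _ => (hdq r).hasDerivAt) (hgc.intervalIntegrable _ _)
        (hcdq.intervalIntegrable _ _), hq0, hq1]
      ring
    rw [e2] at hw
    simp only [sub_mul]
    rw [intervalIntegral.integral_sub, e4]
    · have h3 : (n * ballVolume n) * ((∫ r in (0 : ℝ)..1, u r * deriv q r)
          + ∫ r in (0 : ℝ)..1, g r * q r) = 0 := by
        linarith
      have := (mul_eq_zero.1 h3).resolve_left (by positivity)
      linarith
    · exact ((by rwa [uIcc_of_le zero_le_one] : ContinuousOn u (uIcc 0 1)).mul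
        hcdq.continuousOn).intervalIntegrable
    · exact (hΓc.mul hcdq).intervalIntegrable _ _
  intro r hr
  have := key r hr
  simp only [primitive_one] at this
  linarith

/-- Functions in `H¹₀` with a differentiable radial profile vanish on the boundary. -/
lemma radial_profile_one_eq_zero (hn : 2 ≤ n) {u g : ℝ → ℝ} (hg : Continuous g)
    (hu : ∀ r ∈ Icc (0 : ℝ) 1, u r = u 1 + primitive g r)
    {G : EuclideanSpace ℝ (Fin n) → EuclideanSpace ℝ (Fin n)}
    (hG : MemH10 (unitBall n) (radialFun n u) G) : u 1 = 0 := by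
  have hfin := isFiniteMeasure_unitBall (n := n)
  have hω := ballVolume_pos n
  have hn0 : (0 : ℝ) < n := by positivity
  -- The weights |x|^(2N) concentrate at the sphere. In the integration by parts valid in H¹₀, the
  -- gradient side tends to 0 by dominated convergence, while the other side tends to -n |B₁| u(1).
  have hA : ∀ N : ℕ, ContDiff ℝ 1 fun x : EuclideanSpace ℝ (Fin n) => (‖x‖ ^ 2) ^ N := fun N =>
    (contDiff_norm_sq ℝ).pow N
  have hdA : ∀ (N : ℕ) (x : EuclideanSpace ℝ (Fin n)),
      fderiv ℝ (fun x : EuclideanSpace ℝ (Fin n) => (‖x‖ ^ 2) ^ N) x x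
        = 2 * N * (‖x‖ ^ 2) ^ N := fun N x => by
    have h : HasFDerivAt (fun x : EuclideanSpace ℝ (Fin n) => (‖x‖ ^ 2) ^ N) _ x :=
      (hasStrictFDerivAt_norm_sq x).hasFDerivAt.pow N
    rw [h.fderiv]
    rcases N with _ | N
    · simp
    · simp
      ring
  have hibp := fun N => hG.setIntegral_mul_inner (hA N)
  have e : ∀ N : ℕ, ∫ x in unitBall n, radialFun n u x * (n * (‖x‖ ^ 2) ^ N
      + fderiv ℝ (fun x : EuclideanSpace ℝ (Fin n) => (‖x‖ ^ 2) ^ N) x x)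
      = n * ballVolume n * (u 1 - ∫ r in (0 : ℝ)..1, g r * r ^ (n + 2 * N)) := fun N => by
    simp only [hdA, radialFun]
    rw [setIntegral_unitBall_norm hn fun r => u r * (n * (r ^ 2) ^ N + 2 * N * (r ^ 2) ^ N)]
    congr 1
    have h1 : ∫ r in (0 : ℝ)..1, (u 1 + primitive g r) * (((n + 2 * N : ℕ) : ℝ) * r ^ (n + 2 * N - 1))
        = u 1 - ∫ r in (0 : ℝ)..1, g r * r ^ (n + 2 * N) := by
      rw [intervalIntegral.integral_mul_deriv_eq_deriv_mul
        (fun r _ => (hasDerivAt_primitive hg r).const_add (u 1))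
        (fun r _ => hasDerivAt_pow (n + 2 * N) r) (hg.intervalIntegrable _ _)
        (Continuous.intervalIntegrable (by fun_prop) _ _), primitive_one, one_pow,
        zero_pow (by omega)]
      ring
    rw [← h1]
    refine intervalIntegral.integral_congr fun r hr => ?_
    rw [uIcc_of_le zero_le_one] at hr
    rw [hu r hr, show n + 2 * N - 1 = (n - 1) + 2 * N by omega, pow_add, pow_mul]
    push_cast
    ring
  have l1 : Tendsto (fun N : ℕ => ∫ x in unitBall n, (‖x‖ ^ 2) ^ N * inner ℝ (G x) x) atTop
      (𝓝 (∫ x in unitBall n, (0 : ℝ))) := by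
    refine tendsto_integral_of_dominated_convergence (fun x => ‖G x‖) (fun N => ?_)
      (hG.2.1.integrable (by norm_num)).norm (fun N => ?_) ?_
    · exact ((hA N).continuous.aestronglyMeasurable).mul
        (hG.2.1.aestronglyMeasurable.inner continuous_id.aestronglyMeasurable)
    · refine (ae_restrict_iff' measurableSet_unitBall).2 (Eventually.of_forall fun x hx => ?_)
      have hx1 : ‖x‖ ≤ 1 := (mem_unitBall.1 hx).le
      rw [norm_mul, norm_pow, norm_pow, norm_norm]
      calc (‖x‖ ^ 2) ^ N * ‖inner ℝ (G x) x‖ ≤ 1 * (‖G x‖ * ‖x‖) := by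
            gcongr
            · exact pow_le_one₀ (by positivity) (pow_le_one₀ (norm_nonneg _) hx1)
            · exact norm_inner_le_norm _ _
        _ ≤ ‖G x‖ := by
            rw [one_mul]
            exact mul_le_of_le_one_right (norm_nonneg _) hx1
    · refine (ae_restrict_iff' measurableSet_unitBall).2 (Eventually.of_forall fun x hx => ?_)
      have := (tendsto_pow_atTop_nhds_zero_of_lt_one (sq_nonneg ‖x‖)
        (pow_lt_one₀ (norm_nonneg _) (mem_unitBall.1 hx) two_ne_zero)).mul_const (inner ℝ (G x) x)
      simpa using this
  obtain ⟨C, hC⟩ := (isCompact_Icc (a := (0 : ℝ)) (b := 1)).exists_bound_of_continuousOn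
    hg.continuousOn
  have l2 : Tendsto (fun N : ℕ => ∫ r in (0 : ℝ)..1, g r * r ^ (n + 2 * N)) atTop
      (𝓝 (∫ _ in (0 : ℝ)..1, (0 : ℝ))) := by
    refine intervalIntegral.tendsto_integral_filter_of_dominated_convergence (fun _ => C)
      (Eventually.of_forall fun N => (hg.mul (continuous_pow _)).aestronglyMeasurable)
      (Eventually.of_forall fun N => Eventually.of_forall fun r hr => ?_)
      intervalIntegrable_const ?_
    · rw [uIoc_of_le zero_le_one] at hr
      rw [norm_mul, norm_pow, Real.norm_of_nonneg hr.1.le]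
      exact (mul_le_of_le_one_right (norm_nonneg _) (pow_le_one₀ hr.1.le hr.2)).trans
        (hC r ⟨hr.1.le, hr.2⟩)
    · have hne : ∀ᵐ r : ℝ ∂volume, r ≠ 1 := by simp [ae_iff]
      filter_upwards [hne] with r hr1 hr
      rw [uIoc_of_le zero_le_one] at hr
      have hk : Tendsto (fun N : ℕ => n + 2 * N) atTop atTop :=
        tendsto_atTop_mono (fun N : ℕ => (by omega : N ≤ n + 2 * N)) tendsto_id
      have := ((tendsto_pow_atTop_nhds_zero_of_lt_one hr.1.le (lt_of_le_of_ne hr.2 hr1)).comp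
        hk).const_mul (g r)
      simpa using this
  have l3 := ((tendsto_const_nhds (x := u 1)).sub l2).const_mul (n * ballVolume n) |>.neg
  simp only [← e, ← hibp] at l3
  have := tendsto_nhds_unique l1 l3
  simp only [integral_zero, intervalIntegral.integral_zero, sub_zero, zero_eq_neg] at this
  exact (mul_eq_zero.1 this).resolve_left (by positivity)

/-! ### The profile of a radial eigenfunction -/

/-- The function `V [φ]` for `φ x = u |x|`, extended by zero outside the unit ball. -/
def source (V : EuclideanSpace ℝ (Fin n) → ℝ) (u : ℝ → ℝ) : EuclideanSpace ℝ (Fin n) → ℝ :=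
  (unitBall n).indicator fun x => V x * oscillation V (radialFun n u) x

/-- The derivative of the profile of a radial solution of `-Δφ = μ V [φ]`. -/
def slope (V : EuclideanSpace ℝ (Fin n) → ℝ) (u : ℝ → ℝ) (μ : ℝ) (r : ℝ) : ℝ :=
  -(μ / (n * ballVolume n)) * (ballMass (source V u) r / r ^ (n - 1))

lemma source_of_mem {V : EuclideanSpace ℝ (Fin n) → ℝ} {u : ℝ → ℝ} {x : EuclideanSpace ℝ (Fin n)}
    (hx : x ∈ unitBall n) : source V u x = V x * (u ‖x‖ - average V (radialFun n u)) := by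
  simp [source, hx, oscillation, radialFun]

lemma continuousOn_radialFun {u : ℝ → ℝ} (hu : ContinuousOn u (Icc 0 1)) :
    ContinuousOn (radialFun n u) (Metric.closedBall 0 1) :=
  hu.comp continuous_norm.continuousOn fun x hx => ⟨norm_nonneg x, by simpa using hx⟩

lemma integrableOn_unitBall {b : EuclideanSpace ℝ (Fin n) → ℝ}
    (hb : ContinuousOn b (Metric.closedBall 0 1)) : IntegrableOn b (unitBall n) :=
  (hb.integrableOn_compact (isCompact_closedBall _ _)).mono_set Metric.ball_subset_closedBall

lemma continuousOn_oscillation {V : EuclideanSpace ℝ (Fin n) → ℝ}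
    (hVc : ContinuousOn V (Metric.closedBall 0 1)) {u : ℝ → ℝ} (hu : ContinuousOn u (Icc 0 1)) :
    ContinuousOn (fun x => V x * oscillation V (radialFun n u) x) (Metric.closedBall 0 1) :=
  hVc.mul ((continuousOn_radialFun hu).sub continuousOn_const)

lemma integrable_source {V : EuclideanSpace ℝ (Fin n) → ℝ}
    (hVc : ContinuousOn V (Metric.closedBall 0 1)) {u : ℝ → ℝ} (hu : ContinuousOn u (Icc 0 1)) :
    Integrable (source V u) :=
  (integrable_indicator_iff measurableSet_unitBall).2
    (integrableOn_unitBall (continuousOn_oscillation hVc hu))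

lemma exists_bound_source {V : EuclideanSpace ℝ (Fin n) → ℝ}
    (hVc : ContinuousOn V (Metric.closedBall 0 1)) {u : ℝ → ℝ} (hu : ContinuousOn u (Icc 0 1)) :
    ∃ C, ∀ x, |source V u x| ≤ C := by
  obtain ⟨C, hC⟩ := exists_bound_on_unitBall (continuousOn_oscillation hVc hu)
  refine ⟨max C 0, fun x => ?_⟩
  by_cases hx : x ∈ unitBall n
  · rw [source, indicator_of_mem hx]
    exact (hC x hx).trans (le_max_left _ _)
  · rw [source, indicator_of_notMem hx, abs_zero]
    exact le_max_right _ _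

lemma continuous_slope (hn : 2 ≤ n) {V : EuclideanSpace ℝ (Fin n) → ℝ}
    (hVc : ContinuousOn V (Metric.closedBall 0 1)) {u : ℝ → ℝ} (hu : ContinuousOn u (Icc 0 1))
    (μ : ℝ) : Continuous (slope V u μ) := by
  obtain ⟨C, hC⟩ := exists_bound_source hVc hu
  exact continuous_const.mul (continuous_ballMass_div hn (integrable_source hVc hu) hC)

lemma setIntegral_weight_pos {V : EuclideanSpace ℝ (Fin n) → ℝ}
    (hVc : ContinuousOn V (Metric.closedBall 0 1)) (hV0 : ∀ x ∈ Metric.closedBall 0 1, 0 < V x) :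
    0 < ∫ x in unitBall n, V x := by
  have hpos : ∀ x ∈ unitBall n, 0 < V x := fun x hx => hV0 x (Metric.ball_subset_closedBall hx)
  rw [setIntegral_pos_iff_support_of_nonneg_ae ((ae_restrict_iff' measurableSet_unitBall).2
    (Eventually.of_forall fun x hx => (hpos x hx).le)) (integrableOn_unitBall hVc),
    inter_eq_self_of_subset_right
      (show unitBall n ⊆ Function.support V from fun x hx => (hpos x hx).ne')]
  exact Metric.measure_ball_pos _ _ one_pos

/-- Subtracting the weighted average makes the integral of V[φ] vanish. For the profile this amounts
to the extra boundary condition u'(1) = 0. -/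
lemma ballMass_source_one {V : EuclideanSpace ℝ (Fin n) → ℝ}
    (hVc : ContinuousOn V (Metric.closedBall 0 1)) (hV0 : ∀ x ∈ Metric.closedBall 0 1, 0 < V x)
    {u : ℝ → ℝ} (hu : ContinuousOn u (Icc 0 1)) : ballMass (source V u) 1 = 0 := by
  have h0 := setIntegral_weight_pos hVc hV0
  have h1 : ballMass (source V u) 1 = ∫ x in unitBall n,
      (V x * radialFun n u x - V x * average V (radialFun n u)) := by
    refine setIntegral_congr_fun measurableSet_unitBall fun x hx => ?_
    rw [source_of_mem hx, radialFun]
    ring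
  rw [h1, integral_sub, integral_mul_const, average]
  · field_simp
    ring
  · exact integrableOn_unitBall (hVc.mul (continuousOn_radialFun hu))
  · exact (integrableOn_unitBall hVc).mul_const _

/-- The profile of a radial eigenfunction is the primitive of its slope. -/
lemma IsEigenfunction.eq_primitive_slope (hn : 2 ≤ n) {V : EuclideanSpace ℝ (Fin n) → ℝ}
    (hVc : ContinuousOn V (Metric.closedBall 0 1)) {u : ℝ → ℝ} (hu : ContinuousOn u (Icc 0 1))
    {lam σ : ℝ} (hφ : IsEigenfunction lam V σ (radialFun n u)) :
    ∀ r ∈ Icc (0 : ℝ) 1, u r = primitive (slope V u (lam + σ)) r := by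
  obtain ⟨-, G, hG, hweak⟩ := hφ
  obtain ⟨C, hC⟩ := exists_bound_source hVc hu
  have h1 := radial_profile_eq hn hu hG (integrable_source hVc hu) hC (μ := lam + σ)
    fun η hη => by
      have e : ∫ x in unitBall n, source V u x * η x
          = ∫ x in unitBall n, V x * oscillation V (radialFun n u) x * η x :=
        setIntegral_congr_fun measurableSet_unitBall fun x hx => by
          simp only [source, indicator_of_mem hx]
      rw [e]
      linarith [hweak η hη]
  have h2 := radial_profile_one_eq_zero hn (continuous_slope hn hVc hu (lam + σ)) h1 hG
  intro r hr
  rw [h1 r hr, h2, zero_add]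
  rfl

/-! ### The variational inequality -/

/-- Adding `lam` to a Rayleigh quotient with nonzero denominator leaves a quotient of nonnegative
integrals. A zero denominator gives the default value 0, which is at least `-lam` since `lam` is
nonnegative. -/
lemma lam_add_firstEigenvalue_nonneg {lam : ℝ} (hlam : 0 ≤ lam)
    {V : EuclideanSpace ℝ (Fin n) → ℝ} (hV : ∀ x ∈ unitBall n, 0 ≤ V x) :
    0 ≤ lam + firstEigenvalue lam V ∧
    BddBelow {ρ : ℝ | ∃ (φ : EuclideanSpace ℝ (Fin n) → ℝ)
      (G : EuclideanSpace ℝ (Fin n) → EuclideanSpace ℝ (Fin n)),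
      MemH10 (unitBall n) φ G ∧ (¬ φ =ᵐ[volume.restrict (unitBall n)] 0) ∧
      ρ = ((∫ x in unitBall n, ‖G x‖ ^ 2)
          - lam * ∫ x in unitBall n, V x * oscillation V φ x ^ 2)
        / ∫ x in unitBall n, V x * oscillation V φ x ^ 2} := by
  have h : ∀ ρ ∈ {ρ : ℝ | ∃ (φ : EuclideanSpace ℝ (Fin n) → ℝ)
      (G : EuclideanSpace ℝ (Fin n) → EuclideanSpace ℝ (Fin n)),
      MemH10 (unitBall n) φ G ∧ (¬ φ =ᵐ[volume.restrict (unitBall n)] 0) ∧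
      ρ = ((∫ x in unitBall n, ‖G x‖ ^ 2)
          - lam * ∫ x in unitBall n, V x * oscillation V φ x ^ 2)
        / ∫ x in unitBall n, V x * oscillation V φ x ^ 2}, -lam ≤ ρ := by
    rintro ρ ⟨φ, G, -, -, rfl⟩
    have hA : 0 ≤ ∫ x in unitBall n, ‖G x‖ ^ 2 := integral_nonneg fun x => by positivity
    have hB : 0 ≤ ∫ x in unitBall n, V x * oscillation V φ x ^ 2 :=
      setIntegral_nonneg measurableSet_unitBall fun x hx => mul_nonneg (hV x hx) (sq_nonneg _)
    rcases hB.eq_or_lt with h | h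
    · rw [← h, div_zero]
      linarith
    · rw [le_div_iff₀ h]
      linarith
  refine ⟨?_, ⟨-lam, h⟩⟩
  -- The side condition `-lam ≤ 0` covers the default infimum 0 of an empty set.
  have := Real.le_sInf h (by linarith)
  rw [firstEigenvalue]
  linarith

/-- The variational inequality for the first eigenvalue. -/
lemma MemH10.mul_integral_oscillation_le {lam : ℝ} (hlam : 0 ≤ lam)
    {V : EuclideanSpace ℝ (Fin n) → ℝ} (hV : ∀ x ∈ unitBall n, 0 ≤ V x)
    {w : EuclideanSpace ℝ (Fin n) → ℝ} {G : EuclideanSpace ℝ (Fin n) → EuclideanSpace ℝ (Fin n)}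
    (hw : MemH10 (unitBall n) w G) :
    (lam + firstEigenvalue lam V) * ∫ x in unitBall n, V x * oscillation V w x ^ 2
      ≤ ∫ x in unitBall n, ‖G x‖ ^ 2 := by
  have hA : 0 ≤ ∫ x in unitBall n, ‖G x‖ ^ 2 := integral_nonneg fun x => by positivity
  have hB : 0 ≤ ∫ x in unitBall n, V x * oscillation V w x ^ 2 :=
    setIntegral_nonneg measurableSet_unitBall fun x hx => mul_nonneg (hV x hx) (sq_nonneg _)
  rcases hB.eq_or_lt with h | h
  · rwa [← h, mul_zero]
  · have hne : ¬ w =ᵐ[volume.restrict (unitBall n)] 0 := fun h0 => by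
      have hav : average V w = 0 := by
        have : ∫ x in unitBall n, V x * w x = 0 :=
          integral_eq_zero_of_ae (h0.mono fun x hx => by simp [hx])
        rw [average, this, zero_div]
      refine h.ne' (integral_eq_zero_of_ae (h0.mono fun x hx => ?_))
      simp [oscillation, hav, hx]
    have := csInf_le (lam_add_firstEigenvalue_nonneg hlam hV).2 ⟨w, G, hw, hne, rfl⟩
    rw [le_div_iff₀ h] at this
    rw [firstEigenvalue, add_mul]
    linarith

/-! ### Behaviour at the boundary: unique continuation and positivity -/

lemma radialFun_ae_eq_zero {u : ℝ → ℝ} (h : ∀ r ∈ Icc (0 : ℝ) 1, u r = 0) :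
    radialFun n u =ᵐ[volume.restrict (unitBall n)] 0 :=
  (ae_restrict_iff' measurableSet_unitBall).2 (Eventually.of_forall fun x hx =>
    h ‖x‖ ⟨norm_nonneg x, (mem_unitBall.1 hx).le⟩)

lemma primitive_sub_primitive {g : ℝ → ℝ} (hg : Continuous g) (r s : ℝ) :
    primitive g s - primitive g r = ∫ t in r..s, g t := by
  rw [primitive, primitive, ← intervalIntegral.integral_add_adjacent_intervals
    (hg.intervalIntegrable r s) (hg.intervalIntegrable s 1)]
  ring

/-- Unique continuation from the boundary: a solution with zero average vanishes. -/
lemma eq_zero_of_average_eq_zero (hn : 2 ≤ n) {V : EuclideanSpace ℝ (Fin n) → ℝ}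
    (hVc : ContinuousOn V (Metric.closedBall 0 1)) (hV0 : ∀ x ∈ Metric.closedBall 0 1, 0 < V x)
    {u : ℝ → ℝ} (hu : ContinuousOn u (Icc 0 1)) {μ : ℝ}
    (hug : ∀ r ∈ Icc (0 : ℝ) 1, u r = primitive (slope V u μ) r)
    (hm : average V (radialFun n u) = 0) : ∀ r ∈ Icc (0 : ℝ) 1, u r = 0 := by
  have hω := ballVolume_pos n
  have hg := continuous_slope hn hVc hu μ
  have hW := integrable_source hVc hu
  obtain ⟨CV, hCV⟩ := exists_bound_on_unitBall hVc
  have hCV0 : 0 ≤ CV := (norm_nonneg _).trans (hCV 0 (by simp [mem_unitBall]))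
  -- The vanishing of u on [s, 1] is propagated inwards: if the infimum `s₀` of such s were
  -- positive, u would also vanish on a slightly longer interval.
  set S := {s : ℝ | s ∈ Icc (0 : ℝ) 1 ∧ ∀ r ∈ Icc s 1, u r = 0} with hS
  have h1S : (1 : ℝ) ∈ S := ⟨by simp, fun r hr => by
    rw [hug r ⟨zero_le_one.trans hr.1, hr.2⟩, le_antisymm hr.2 hr.1, primitive_one]⟩
  have hbdd : BddBelow S := ⟨0, fun s hs => hs.1.1⟩
  set s₀ := sInf S with hs₀
  have hs₀0 : 0 ≤ s₀ := le_csInf ⟨1, h1S⟩ fun s hs => hs.1.1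
  have hs₀1 : s₀ ≤ 1 := csInf_le hbdd h1S
  have hs₀S : ∀ r ∈ Icc s₀ 1, u r = 0 := by
    have hgt : ∀ r ∈ Ioc s₀ 1, u r = 0 := fun r hr => by
      obtain ⟨s, hs, hsr⟩ := exists_lt_of_csInf_lt ⟨1, h1S⟩ hr.1
      exact hs.2 r ⟨hsr.le, hr.2⟩
    intro r hr
    rcases hr.1.eq_or_lt with h | h
    · subst h
      rcases hs₀1.eq_or_lt with h1 | h1
      · rw [h1]
        exact h1S.2 1 (by simp)
      · have hcl : s₀ ∈ closure (Ioc s₀ 1) := by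
          rw [closure_Ioc h1.ne]
          exact left_mem_Icc.2 hs₀1
        have hΓ : Continuous (primitive (slope V u μ)) :=
          continuous_iff_continuousAt.2 fun r => (hasDerivAt_primitive hg r).continuousAt
        rw [hug s₀ ⟨hs₀0, hs₀1⟩]
        exact (isClosed_singleton.preimage hΓ).closure_subset_iff.2 (fun r hr => by
          rw [mem_preimage, ← hug r ⟨hs₀0.trans hr.1.le, hr.2⟩]
          exact hgt r hr) hcl
    · exact hgt r ⟨h, hr.2⟩
  rcases hs₀0.eq_or_lt with h0 | h0
  · rwa [← h0] at hs₀S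
  exfalso
  -- On an interval [s₀ - ε, s₀] with ε ≤ s₀/2, the slope is at most L times the maximum K of |u|
  -- there. Integrating from `s₀`, where u = 0, gives K ≤ ε L K, and ε L < 1 forces K = 0.
  set L := |μ / (n * ballVolume n)| * (CV * ballVolume n / (s₀ / 2) ^ (n - 1)) with hL
  have hL0 : 0 ≤ L := by positivity
  obtain ⟨ε, hε0, hε1, hε2⟩ : ∃ ε : ℝ, 0 < ε ∧ ε ≤ s₀ / 2 ∧ ε * L < 1 := by
    refine ⟨min (s₀ / 2) (1 / (L + 1)), by positivity, min_le_left _ _, ?_⟩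
    calc min (s₀ / 2) (1 / (L + 1)) * L ≤ 1 / (L + 1) * L := by gcongr; exact min_le_right _ _
      _ < 1 := by rw [one_div, inv_mul_lt_one₀ (by positivity)]; linarith
  have hsub : Icc (s₀ - ε) s₀ ⊆ Icc 0 1 := Icc_subset_Icc (by linarith) hs₀1
  obtain ⟨r₁, hr₁, hmax⟩ := (isCompact_Icc (a := s₀ - ε) (b := s₀)).exists_isMaxOn
    ⟨s₀, by simp [hε0.le]⟩ (hu.mono hsub).abs
  set K := |u r₁| with hK
  -- The total mass is zero and the shell outside `s₀` contributes nothing. For r < s₀ the mass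
  -- therefore only sees the thin shell between r and `s₀`.
  have hmass : ballMass (source V u) s₀ = 0 := by
    have := abs_ballMass_sub_le hn hW (C := 0) hs₀0 hs₀1 fun x h1 h2 => by
      rw [source_of_mem (mem_unitBall.2 h2), hm, hs₀S ‖x‖ ⟨h1, h2.le⟩]
      simp
    rw [ballMass_source_one hVc hV0 hu, zero_mul, zero_sub, abs_neg] at this
    exact abs_nonpos_iff.1 this
  have hslope : ∀ r ∈ Icc (s₀ - ε) s₀, |slope V u μ r| ≤ L * K := fun r hr => by
    have hr0 : s₀ / 2 ≤ r := by linarith [hr.1]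
    have hrp : 0 < r := by linarith
    have h1 := abs_ballMass_sub_le hn hW (C := CV * K) hrp.le hr.2 fun x h1 h2 => by
      have hx : x ∈ unitBall n := mem_unitBall.2 (h2.trans_le hs₀1)
      rw [source_of_mem hx, hm, sub_zero, abs_mul]
      exact mul_le_mul (hCV x hx) (hmax (a := ‖x‖) ⟨hr.1.trans h1, h2.le⟩) (abs_nonneg _) hCV0
    rw [hmass, zero_sub, abs_neg] at h1
    have h2 : (s₀ ^ n - r ^ n) * ballVolume n ≤ 1 * ballVolume n := by
      gcongr
      linarith [pow_le_one₀ hs₀0 hs₀1 (n := n), pow_pos hrp n]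
    have h3 : |ballMass (source V u) r| ≤ CV * K * (1 * ballVolume n) :=
      h1.trans (mul_le_mul_of_nonneg_left h2 (by positivity))
    rw [slope, abs_mul, abs_neg, abs_div (ballMass _ _), abs_of_pos (pow_pos hrp (n - 1)), hL,
      mul_assoc]
    refine mul_le_mul_of_nonneg_left ?_ (abs_nonneg _)
    calc |ballMass (source V u) r| / r ^ (n - 1)
        ≤ CV * K * (1 * ballVolume n) / (s₀ / 2) ^ (n - 1) := by gcongr
      _ = _ := by ring
  have hbound : ∀ r ∈ Icc (s₀ - ε) s₀, |u r| ≤ ε * L * K := fun r hr => by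
    have h1 : u r = -∫ t in r..s₀, slope V u μ t := by
      rw [← primitive_sub_primitive hg, ← hug r (hsub hr), ← hug s₀ ⟨hs₀0, hs₀1⟩,
        hs₀S s₀ ⟨le_rfl, hs₀1⟩]
      ring
    rw [h1, abs_neg]
    have h2 := intervalIntegral.norm_integral_le_of_norm_le_const (a := r) (b := s₀)
      (f := slope V u μ) (C := L * K) fun t ht => by
        rw [uIoc_of_le hr.2] at ht
        exact hslope t ⟨hr.1.trans ht.1.le, ht.2⟩
    refine h2.trans ?_
    rw [abs_of_nonneg (by linarith [hr.2])]
    calc L * K * (s₀ - r) ≤ L * K * ε := by gcongr; linarith [hr.1]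
      _ = ε * L * K := by ring
  have hK0 : K = 0 := by
    have h1 : K ≤ ε * L * K := hbound r₁ hr₁
    have h2 : 0 ≤ K := abs_nonneg _
    nlinarith
  have hmem : s₀ - ε ∈ S := by
    refine ⟨hsub (left_mem_Icc.2 (by linarith)), fun r hr => ?_⟩
    rcases le_total r s₀ with h | h
    · have := hbound r ⟨hr.1, h⟩
      rw [hK0, mul_zero] at this
      exact abs_nonpos_iff.1 this
    · exact hs₀S r ⟨h, hr.2⟩
  linarith [csInf_le hbdd hmem]

/-- A solution with positive average is positive near the boundary. -/
lemma exists_pos_near_one (hn : 2 ≤ n) {V : EuclideanSpace ℝ (Fin n) → ℝ}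
    (hVc : ContinuousOn V (Metric.closedBall 0 1)) (hV0 : ∀ x ∈ Metric.closedBall 0 1, 0 < V x)
    {u : ℝ → ℝ} (hu : ContinuousOn u (Icc 0 1)) {μ : ℝ} (hμ : 0 < μ)
    (hug : ∀ r ∈ Icc (0 : ℝ) 1, u r = primitive (slope V u μ) r)
    (hm : 0 < average V (radialFun n u)) :
    ∃ t : ℝ, 0 ≤ t ∧ t < 1 ∧ ∀ r ∈ Ioo t 1, 0 < u r := by
  have hω := ballVolume_pos n
  have hg := continuous_slope hn hVc hu μ
  have hW := integrable_source hVc hu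
  have hu1 : u 1 = 0 := by rw [hug 1 (by simp), primitive_one]
  -- As u(1) = 0 lies below the average, the oscillation is negative near the sphere.
  have hev : ∀ᶠ r in 𝓝[Icc 0 1] (1 : ℝ), u r < average V (radialFun n u) :=
    (hu 1 (by simp)).eventually (Iio_mem_nhds (by rwa [hu1]))
  obtain ⟨δ, hδ, hball⟩ := Metric.mem_nhdsWithin_iff.1 hev
  have hlt : ∀ r, 0 ≤ r → 1 - δ < r → r ≤ 1 → u r < average V (radialFun n u) :=
    fun r h0 h1 h2 => hball ⟨by
      rw [Metric.mem_ball, Real.dist_eq, abs_lt]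
      constructor <;> linarith, h0, h2⟩
  refine ⟨max 0 (1 - δ), le_max_left _ _, max_lt one_pos (by linarith), fun r hr => ?_⟩
  have hslope : ∀ s ∈ Ioo r 1, 0 < -slope V u μ s := fun s hs => by
    have hs0 : 0 < s := ((le_max_left _ _).trans_lt hr.1).trans hs.1
    have hs1 : 1 - δ < s := ((le_max_right _ _).trans_lt hr.1).trans hs.1
    -- Since the total mass is zero, the mass inside radius s is minus that of the outer shell,
    -- where the source is negative. The slope there is then negative, and u decreases to u(1) = 0.
    have hM : 0 < ballMass (source V u) s := by
      have h1 := ballMass_sub hW hs.2.le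
      rw [ballMass_source_one hVc hV0 hu, zero_sub] at h1
      rw [← neg_neg (ballMass (source V u) s), h1, ← integral_neg]
      have hneg : ∀ x ∈ Metric.ball (0 : EuclideanSpace ℝ (Fin n)) 1 \ Metric.ball 0 s,
          0 < -source V u x := fun x hx => by
        simp only [Set.mem_sdiff, mem_ball_zero_iff, not_lt] at hx
        rw [source_of_mem (mem_unitBall.2 hx.1), ← mul_neg]
        refine mul_pos (hV0 x (by simpa using hx.1.le)) ?_
        linarith [hlt ‖x‖ (norm_nonneg x) (hs1.trans_le hx.2) hx.1.le]
      have hmeas : MeasurableSet (Metric.ball (0 : EuclideanSpace ℝ (Fin n)) 1 \ Metric.ball 0 s) :=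
        Metric.isOpen_ball.measurableSet.diff Metric.isOpen_ball.measurableSet
      rw [setIntegral_pos_iff_support_of_nonneg_ae ((ae_restrict_iff' hmeas).2
        (Eventually.of_forall fun x hx => (hneg x hx).le)) hW.neg.integrableOn,
        inter_eq_self_of_subset_right
          (show _ ⊆ Function.support fun x => -source V u x from fun x hx => (hneg x hx).ne')]
      refine (ENNReal.toReal_pos_iff.1 (?_ : 0 < volume.real _)).1
      rw [volume_real_shell hn hs0.le hs.2.le, one_pow]
      exact mul_pos (sub_pos.2 (pow_lt_one₀ hs0.le hs.2 (by omega))) hω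
    rw [slope, neg_mul, neg_neg]
    have := pow_pos hs0 (n - 1)
    have hn0 : (0 : ℝ) < n := by positivity
    positivity
  have h0 := intervalIntegral.intervalIntegral_pos_of_pos_on (hg.neg.intervalIntegrable r 1)
    hslope hr.2
  rw [hug r ⟨(le_max_left _ _).trans hr.1.le, hr.2.le⟩, primitive, ← intervalIntegral.integral_neg]
  exact h0

/-! ### Positivity intervals and the truncated test functions -/

/-- An interval of radii on which the profile `u` is nonnegative and not identically zero, and at
whose end points, other than the origin, `u` vanishes. -/
structure IsPosInterval (u : ℝ → ℝ) (a b : ℝ) : Prop where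
  nonneg_left : 0 ≤ a
  lt : a < b
  le_one : b ≤ 1
  nonneg : ∀ r ∈ Icc a b, 0 ≤ u r
  left : a = 0 ∨ u a = 0
  right : u b = 0
  exists_pos : ∃ r ∈ Ioo a b, 0 < u r

/-- The primitive of the truncation of `u'` to an interval is the truncation of `u`. -/
lemma IsPosInterval.primitive_indicator {u g : ℝ → ℝ} (hg : Continuous g)
    (hug : ∀ r ∈ Icc (0 : ℝ) 1, u r = primitive g r) {a b : ℝ} (h : IsPosInterval u a b)
    {r : ℝ} (hr : r ∈ Icc (0 : ℝ) 1) :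
    primitive ((Ioc a b).indicator g) r = (Icc a b).indicator u r := by
  have hua : ∀ s ∈ Icc a b, u s = primitive g s := fun s hs =>
    hug s ⟨h.nonneg_left.trans hs.1, hs.2.trans h.le_one⟩
  have hint : ∀ s ∈ Icc a b, ∫ t in Ioc s b, g t = -u s := fun s hs => by
    rw [← intervalIntegral.integral_of_le hs.2, ← primitive_sub_primitive hg, ← hua s hs,
      ← hua b (right_mem_Icc.2 h.lt.le), h.right, zero_sub]
  rw [primitive, intervalIntegral.integral_of_le hr.2, setIntegral_indicator measurableSet_Ioc,
    Ioc_inter_Ioc, min_eq_right h.le_one]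
  rcases lt_trichotomy r a with h1 | h1 | h1
  · have ha : u a = 0 := h.left.resolve_left (by linarith [hr.1])
    rw [max_eq_right h1.le, hint a (left_mem_Icc.2 h.lt.le), ha,
      indicator_of_notMem fun h' => absurd h'.1 (not_le.2 h1)]
    simp
  · rw [h1, max_self, hint a (left_mem_Icc.2 h.lt.le),
      indicator_of_mem (left_mem_Icc.2 h.lt.le), neg_neg]
  · rw [max_eq_left h1.le]
    rcases le_or_gt r b with h2 | h2
    · rw [hint r ⟨h1.le, h2⟩, indicator_of_mem (show r ∈ Icc a b from ⟨h1.le, h2⟩), neg_neg]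
    · rw [Ioc_eq_empty (by linarith), indicator_of_notMem fun h' => absurd h'.2 (not_le.2 h2)]
      simp

lemma exists_bound_indicator {g : ℝ → ℝ} (hg : Continuous g) (a b : ℝ) :
    ∃ C, ∀ r, |(Ioc a b).indicator g r| ≤ C := by
  obtain ⟨C, hC⟩ := (isCompact_Icc (a := a) (b := b)).exists_bound_of_continuousOn hg.continuousOn
  refine ⟨max C 0, fun r => ?_⟩
  by_cases hr : r ∈ Ioc a b
  · rw [indicator_of_mem hr]
    exact (hC r (Ioc_subset_Icc_self hr)).trans (le_max_left _ _)
  · rw [indicator_of_notMem hr, abs_zero]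
    exact le_max_right _ _

/-- The truncation of the radial function with profile `u` to a shell. -/
def truncation (n : ℕ) (g : ℝ → ℝ) (a b : ℝ) : EuclideanSpace ℝ (Fin n) → ℝ :=
  fun x => primitive ((Ioc a b).indicator g) ‖x‖

lemma continuous_truncation {g : ℝ → ℝ} (hg : Continuous g) (a b : ℝ) :
    Continuous (truncation n g a b) := by
  obtain ⟨C, hC⟩ := exists_bound_indicator hg a b
  exact (continuous_primitive (hg.measurable.indicator measurableSet_Ioc) hC).comp continuous_norm

lemma IsPosInterval.truncation_eq {u g : ℝ → ℝ} (hg : Continuous g)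
    (hug : ∀ r ∈ Icc (0 : ℝ) 1, u r = primitive g r) {a b : ℝ} (h : IsPosInterval u a b)
    {x : EuclideanSpace ℝ (Fin n)} (hx : x ∈ unitBall n) :
    truncation n g a b x = (Icc a b).indicator u ‖x‖ :=
  h.primitive_indicator hg hug ⟨norm_nonneg x, (mem_unitBall.1 hx).le⟩

lemma IsPosInterval.truncation_nonneg {u g : ℝ → ℝ} (hg : Continuous g)
    (hug : ∀ r ∈ Icc (0 : ℝ) 1, u r = primitive g r) {a b : ℝ} (h : IsPosInterval u a b)
    {x : EuclideanSpace ℝ (Fin n)} (hx : x ∈ unitBall n) : 0 ≤ truncation n g a b x := by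
  rw [h.truncation_eq hg hug hx]
  exact indicator_nonneg h.nonneg _

/-- The truncation equals φ on its shell and 0 elsewhere. This turns the product of V[φ] with the
truncation into quantities of the truncation alone, as the energy identity requires. -/
lemma IsPosInterval.mul_truncation {u g : ℝ → ℝ} (hg : Continuous g)
    (hug : ∀ r ∈ Icc (0 : ℝ) 1, u r = primitive g r) {a b : ℝ} (h : IsPosInterval u a b)
    {x : EuclideanSpace ℝ (Fin n)} (hx : x ∈ unitBall n) :
    u ‖x‖ * truncation n g a b x = truncation n g a b x ^ 2 := by
  rw [h.truncation_eq hg hug hx]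
  by_cases hr : ‖x‖ ∈ Icc a b
  · rw [indicator_of_mem hr, sq]
  · rw [indicator_of_notMem hr]
    ring

/-- The truncation is nonnegative and continuous, and positivity at a single radius spreads to an
open set of positive measure. -/
lemma IsPosInterval.integral_truncation_pos (hn : 2 ≤ n) {V : EuclideanSpace ℝ (Fin n) → ℝ}
    (hVc : ContinuousOn V (Metric.closedBall 0 1)) (hV0 : ∀ x ∈ Metric.closedBall 0 1, 0 < V x)
    {u g : ℝ → ℝ} (hg : Continuous g) (hug : ∀ r ∈ Icc (0 : ℝ) 1, u r = primitive g r) {a b : ℝ}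
    (h : IsPosInterval u a b) : 0 < ∫ x in unitBall n, V x * truncation n g a b x := by
  have : Nonempty (Fin n) := ⟨⟨0, by omega⟩⟩
  have hct := continuous_truncation (n := n) hg a b
  have hV : ∀ x ∈ unitBall n, 0 < V x := fun x hx => hV0 x (Metric.ball_subset_closedBall hx)
  rw [setIntegral_pos_iff_support_of_nonneg_ae ((ae_restrict_iff' measurableSet_unitBall).2
    (Eventually.of_forall fun x hx => mul_nonneg (hV x hx).le (h.truncation_nonneg hg hug hx)))
    (integrableOn_unitBall (hVc.mul hct.continuousOn))]
  have hopen : IsOpen {x | x ∈ unitBall n ∧ 0 < truncation n g a b x} :=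
    Metric.isOpen_ball.inter (isOpen_lt continuous_const hct)
  obtain ⟨r, hr, hur⟩ := h.exists_pos
  obtain ⟨x, hx⟩ := exists_norm_eq (EuclideanSpace ℝ (Fin n)) (h.nonneg_left.trans hr.1.le)
  have hxB : x ∈ unitBall n := mem_unitBall.2 (hx ▸ hr.2.trans_le h.le_one)
  refine (hopen.measure_pos volume ⟨x, hxB, ?_⟩).trans_le (measure_mono fun y hy => ⟨?_, hy.1⟩)
  · rwa [h.truncation_eq hg hug hxB, hx, indicator_of_mem (Ioo_subset_Icc_self hr)]
  · exact (mul_pos (hV y hy.1) hy.2).ne'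

/-- The Dirichlet energy of the truncation of a solution. -/
lemma IsPosInterval.energy_eq (hn : 2 ≤ n) {V : EuclideanSpace ℝ (Fin n) → ℝ}
    (hVc : ContinuousOn V (Metric.closedBall 0 1))
    {u : ℝ → ℝ} (hu : ContinuousOn u (Icc 0 1)) {μ : ℝ}
    (hug : ∀ r ∈ Icc (0 : ℝ) 1, u r = primitive (slope V u μ) r) {a b : ℝ}
    (h : IsPosInterval u a b) :
    n * ballVolume n * ∫ r in (0 : ℝ)..1, r ^ (n - 1) * (Ioc a b).indicator (slope V u μ) r ^ 2
      = μ * ((∫ x in unitBall n, V x * truncation n (slope V u μ) a b x ^ 2)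
        - average V (radialFun n u) * ∫ x in unitBall n, V x * truncation n (slope V u μ) a b x) := by
  have hg := continuous_slope hn hVc hu μ
  have hω := ballVolume_pos n
  have hn0 : (0 : ℝ) < n := by positivity
  have hct := continuous_truncation (n := n) hg a b
  obtain ⟨C, hC⟩ := exists_bound_indicator hg a b
  -- Fubini with the truncated slope replaces integration by parts: it expresses the integral of
  -- V[φ] times the truncation through the slope and the mass function, and the mass is the slope up
  -- to the factor r^(n-1) and constants.
  have hfub := setIntegral_mul_primitive (integrable_source hVc hu)
    (hg.measurable.indicator measurableSet_Ioc) hC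
  have e1 : ∫ x in unitBall n, source V u x * primitive ((Ioc a b).indicator (slope V u μ)) ‖x‖
      = (∫ x in unitBall n, V x * truncation n (slope V u μ) a b x ^ 2)
        - average V (radialFun n u)
          * ∫ x in unitBall n, V x * truncation n (slope V u μ) a b x := by
    rw [← integral_const_mul, ← integral_sub]
    · refine setIntegral_congr_fun measurableSet_unitBall fun x hx => ?_
      change source V u x * truncation n (slope V u μ) a b x = _
      rw [source_of_mem hx, ← h.mul_truncation hg hug hx]
      ring
    · exact integrableOn_unitBall (hVc.mul (hct.pow 2).continuousOn)
    · exact (integrableOn_unitBall (hVc.mul hct.continuousOn)).const_mul _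
  rw [← e1, hfub, ← intervalIntegral.integral_const_mul, ← intervalIntegral.integral_neg,
    ← intervalIntegral.integral_const_mul]
  refine intervalIntegral.integral_congr fun r hr => ?_
  by_cases hrI : r ∈ Ioc a b
  · have hr0 : 0 < r := h.nonneg_left.trans_lt hrI.1
    simp only [indicator_of_mem hrI]
    rw [sq]
    nth_rewrite 1 [slope]
    field_simp
  · simp [indicator_of_notMem hrI]

lemma primitive_sub_const_mul {P₁ P₂ : ℝ → ℝ} (c₁ c₂ r : ℝ)
    (h₁ : IntervalIntegrable P₁ volume r 1) (h₂ : IntervalIntegrable P₂ volume r 1) :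
    primitive (fun s => c₁ * P₁ s - c₂ * P₂ s) r = c₁ * primitive P₁ r - c₂ * primitive P₂ r := by
  simp only [primitive]
  rw [intervalIntegral.integral_sub (h₁.const_mul c₁) (h₂.const_mul c₂),
    intervalIntegral.integral_const_mul, intervalIntegral.integral_const_mul]
  ring

/-- A first eigenfunction with positive average has no two disjoint positivity intervals. -/
lemma IsPosInterval.false_of_le (hn : 2 ≤ n) {V : EuclideanSpace ℝ (Fin n) → ℝ}
    (hVc : ContinuousOn V (Metric.closedBall 0 1)) (hV0 : ∀ x ∈ Metric.closedBall 0 1, 0 < V x)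
    {u : ℝ → ℝ} (hu : ContinuousOn u (Icc 0 1)) {lam : ℝ} (hlam : 0 ≤ lam)
    (hμ : 0 < lam + firstEigenvalue lam V)
    (hug : ∀ r ∈ Icc (0 : ℝ) 1, u r = primitive (slope V u (lam + firstEigenvalue lam V)) r)
    (hm : 0 < average V (radialFun n u)) {a₁ b₁ a₂ b₂ : ℝ} (h₁ : IsPosInterval u a₁ b₁)
    (h₂ : IsPosInterval u a₂ b₂) (h12 : b₁ ≤ a₂) : False := by
  set μ := lam + firstEigenvalue lam V with hμdef
  set g := slope V u μ with hgdef
  set m := average V (radialFun n u)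
  have hg : Continuous g := continuous_slope hn hVc hu μ
  have hω := ballVolume_pos n
  have hn0 : (0 : ℝ) < n := by positivity
  set P₁ := (Ioc a₁ b₁).indicator g with hP₁
  set P₂ := (Ioc a₂ b₂).indicator g with hP₂
  have hm₁ : Measurable P₁ := hg.measurable.indicator measurableSet_Ioc
  have hm₂ : Measurable P₂ := hg.measurable.indicator measurableSet_Ioc
  obtain ⟨C₁, hC₁⟩ := exists_bound_indicator hg a₁ b₁
  obtain ⟨C₂, hC₂⟩ := exists_bound_indicator hg a₂ b₂
  have hiP : ∀ a b c d : ℝ, IntervalIntegrable ((Ioc a b).indicator g) volume c d :=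
    fun a b c d => by
      obtain ⟨C, hC⟩ := exists_bound_indicator hg a b
      exact (intervalIntegrable_const (c := C)).mono_fun
        (hg.measurable.indicator measurableSet_Ioc).aestronglyMeasurable
        (Eventually.of_forall fun r => (hC r).trans (le_abs_self C))
  set w₁ := truncation n g a₁ b₁ with hw₁
  set w₂ := truncation n g a₂ b₂ with hw₂
  have hc₁ : Continuous w₁ := continuous_truncation hg a₁ b₁
  have hc₂ : Continuous w₂ := continuous_truncation hg a₂ b₂
  have hα₁ := h₁.integral_truncation_pos hn hVc hV0 hg hug
  have hα₂ := h₂.integral_truncation_pos hn hVc hV0 hg hug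
  have hE₁ := h₁.energy_eq hn hVc hu hug
  have hE₂ := h₂.energy_eq hn hVc hu hug
  rw [← hgdef] at hE₁ hE₂
  rw [← hw₁] at hα₁ hE₁
  rw [← hw₂] at hα₂ hE₂
  -- The weights are crossed, each coefficient being the integral of the other truncation, so that
  -- the combination has zero average.
  set c₁ := ∫ x in unitBall n, V x * w₂ x with hc1
  set c₂ := ∫ x in unitBall n, V x * w₁ x with hc2
  set P : ℝ → ℝ := fun r => c₁ * P₁ r - c₂ * P₂ r with hP
  have hPm : Measurable P := (hm₁.const_mul c₁).sub (hm₂.const_mul c₂)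
  have hPb : ∀ r, |P r| ≤ |c₁| * C₁ + |c₂| * C₂ := fun r => by
    refine (abs_sub _ _).trans ?_
    rw [abs_mul, abs_mul]
    exact add_le_add (mul_le_mul_of_nonneg_left (hC₁ r) (abs_nonneg _))
      (mul_le_mul_of_nonneg_left (hC₂ r) (abs_nonneg _))
  have hw : ∀ x : EuclideanSpace ℝ (Fin n), primitive P ‖x‖ = c₁ * w₁ x - c₂ * w₂ x := fun x =>
    primitive_sub_const_mul c₁ c₂ ‖x‖ (hiP a₁ b₁ _ _) (hiP a₂ b₂ _ _)
  have hH := memH10_primitive hn hPm hPb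
  have hray := hH.mul_integral_oscillation_le hlam fun x hx =>
    (hV0 x (Metric.ball_subset_closedBall hx)).le
  rw [← hμdef] at hray
  have i₁ : IntegrableOn (fun x => V x * w₁ x) (unitBall n) :=
    integrableOn_unitBall (hVc.mul hc₁.continuousOn)
  have i₂ : IntegrableOn (fun x => V x * w₂ x) (unitBall n) :=
    integrableOn_unitBall (hVc.mul hc₂.continuousOn)
  have hav : average V (fun x => primitive P ‖x‖) = 0 := by
    have : ∫ x in unitBall n, V x * primitive P ‖x‖ = 0 := by
      have e : ∀ x, V x * primitive P ‖x‖ = c₁ * (V x * w₁ x) - c₂ * (V x * w₂ x) := fun x => by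
        rw [hw]
        ring
      simp_rw [e]
      rw [integral_sub (i₁.const_mul c₁) (i₂.const_mul c₂), integral_const_mul, integral_const_mul]
      ring
    rw [average, this, zero_div]
  -- The closed shells may touch, but only at the radius b₁ = a₂, where u vanishes.
  have hdisj : ∀ x ∈ unitBall n, w₁ x * w₂ x = 0 := fun x hx => by
    rw [hw₁, hw₂, h₁.truncation_eq hg hug hx, h₂.truncation_eq hg hug hx]
    by_cases hr : ‖x‖ ∈ Icc a₁ b₁
    · by_cases hr' : ‖x‖ ∈ Icc a₂ b₂
      · have : ‖x‖ = b₁ := le_antisymm hr.2 (h12.trans hr'.1)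
        rw [indicator_of_mem hr, this, h₁.right, zero_mul]
      · rw [indicator_of_notMem hr', mul_zero]
    · rw [indicator_of_notMem hr, zero_mul]
  have eB : ∫ x in unitBall n, V x * oscillation V (fun x => primitive P ‖x‖) x ^ 2
      = c₁ ^ 2 * (∫ x in unitBall n, V x * w₁ x ^ 2)
        + c₂ ^ 2 * ∫ x in unitBall n, V x * w₂ x ^ 2 := by
    rw [← integral_const_mul, ← integral_const_mul, ← integral_add]
    · refine setIntegral_congr_fun measurableSet_unitBall fun x hx => ?_
      simp only [oscillation]
      rw [hav, sub_zero, hw]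
      linear_combination (-2 * V x * c₁ * c₂) * hdisj x hx
    · exact (integrableOn_unitBall (hVc.mul (hc₁.pow 2).continuousOn)).const_mul _
    · exact (integrableOn_unitBall (hVc.mul (hc₂.pow 2).continuousOn)).const_mul _
  have hP12 : ∀ r, P₁ r * P₂ r = 0 := fun r => by
    by_cases hr : r ∈ Ioc a₁ b₁
    · rw [hP₂, indicator_of_notMem fun h' => absurd (hr.2.trans h12) (not_le.2 h'.1), mul_zero]
    · rw [hP₁, indicator_of_notMem hr, zero_mul]
  have hiE : ∀ a b : ℝ, IntervalIntegrable
      (fun r => r ^ (n - 1) * (Ioc a b).indicator g r ^ 2) volume 0 1 := fun a b => by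
    have e : (fun r => r ^ (n - 1) * (Ioc a b).indicator g r ^ 2)
        = (Ioc a b).indicator fun r => r ^ (n - 1) * g r ^ 2 := by
      ext r
      by_cases hr : r ∈ Ioc a b <;> simp [hr]
    rw [e, intervalIntegrable_iff]
    exact (intervalIntegrable_iff.1 (((continuous_pow _).mul (hg.pow 2)).intervalIntegrable
      0 1)).indicator measurableSet_Ioc
  have eA : ∫ x in unitBall n, ‖P ‖x‖ • (‖x‖⁻¹ • x)‖ ^ 2
      = c₁ ^ 2 * (n * ballVolume n * ∫ r in (0 : ℝ)..1, r ^ (n - 1) * P₁ r ^ 2)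
        + c₂ ^ 2 * (n * ballVolume n * ∫ r in (0 : ℝ)..1, r ^ (n - 1) * P₂ r ^ 2) := by
    have hP0 : P 0 = 0 := by
      have n1 : (0 : ℝ) ∉ Ioc a₁ b₁ := fun h' => absurd h'.1 (not_lt.2 h₁.nonneg_left)
      have n2 : (0 : ℝ) ∉ Ioc a₂ b₂ := fun h' => absurd h'.1 (not_lt.2 h₂.nonneg_left)
      simp [hP, hP₁, hP₂, n1, n2]
    have e1 : ∀ x : EuclideanSpace ℝ (Fin n), ‖P ‖x‖ • (‖x‖⁻¹ • x)‖ ^ 2 = P ‖x‖ ^ 2 := fun x => by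
      rcases eq_or_ne x 0 with rfl | hx
      · simp [hP0]
      · rw [norm_smul, norm_smul, norm_inv, norm_norm, inv_mul_cancel₀ (norm_ne_zero_iff.2 hx),
          mul_one, Real.norm_eq_abs, sq_abs]
    simp_rw [e1]
    rw [setIntegral_unitBall_norm hn fun r => P r ^ 2]
    have e2 : ∫ r in (0 : ℝ)..1, r ^ (n - 1) * P r ^ 2
        = c₁ ^ 2 * (∫ r in (0 : ℝ)..1, r ^ (n - 1) * P₁ r ^ 2)
          + c₂ ^ 2 * ∫ r in (0 : ℝ)..1, r ^ (n - 1) * P₂ r ^ 2 := by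
      rw [← intervalIntegral.integral_const_mul, ← intervalIntegral.integral_const_mul,
        ← intervalIntegral.integral_add ((hiE a₁ b₁).const_mul _) ((hiE a₂ b₂).const_mul _)]
      congr 1
      ext r
      simp only [hP]
      linear_combination (-2 * r ^ (n - 1) * c₁ * c₂) * hP12 r
    rw [e2]
    ring
  rw [eA, eB, hE₁, hE₂] at hray
  -- This is the amount by which the energy falls short of μ ∫ V[w]².
  have hpos : 0 < μ * m * (c₁ ^ 2 * c₂ + c₂ ^ 2 * c₁) := by positivity
  linarith

/-! ### Geometry of radial and generalized nodal domains -/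

lemma radialDeriv_eq {u g : ℝ → ℝ} (hg : Continuous g)
    (hug : ∀ r ∈ Icc (0 : ℝ) 1, u r = primitive g r) {r : ℝ} (hr : r ∈ Icc (0 : ℝ) 1) :
    radialDeriv u r = g r :=
  ((hasDerivAt_primitive hg r).hasDerivWithinAt.congr hug (hug r hr)).derivWithin
    (uniqueDiffOn_Icc zero_lt_one r hr)

/-- A radial domain is a ball or a shell. -/
lemma IsRadialDomain.exists_radii (hn : 2 ≤ n) {D : Set (EuclideanSpace ℝ (Fin n))}
    (hD : IsRadialDomain D) :
    ∃ a b : ℝ, 0 ≤ a ∧ a < b ∧ b ≤ 1 ∧ (∀ x, ‖x‖ ∈ Ioo a b → x ∈ D) ∧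
      (∃ x ∈ frontier D, ‖x‖ = b) ∧ (a = 0 ∨ ∃ x ∈ frontier D, ‖x‖ = a) := by
  have : Nonempty (Fin n) := ⟨⟨0, by omega⟩⟩
  obtain ⟨e, he⟩ := exists_norm_eq (EuclideanSpace ℝ (Fin n)) zero_le_one
  have hnorm : ∀ t : ℝ, 0 ≤ t → ‖t • e‖ = t := fun t ht => by
    rw [norm_smul, he, mul_one, Real.norm_of_nonneg ht]
  have hc : Continuous fun t : ℝ => t • e := by fun_prop
  set T : Set ℝ := {t | t • e ∈ D} with hT
  have hTo : IsOpen T := hD.isOpen.preimage hc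
  set R : Set ℝ := norm '' D with hR
  have hTR : ∀ t, 0 ≤ t → (t ∈ R ↔ t ∈ T) := fun t ht => by
    constructor
    · rintro ⟨x, hx, rfl⟩
      exact hD.radial x _ (hnorm _ ht).symm hx
    · exact fun h => ⟨t • e, h, hnorm t ht⟩
  have hR0 : ∀ t ∈ R, 0 ≤ t := by
    rintro _ ⟨x, -, rfl⟩
    exact norm_nonneg x
  have hR1 : ∀ t ∈ R, t ≤ 1 := by
    rintro _ ⟨x, hx, rfl⟩
    exact (mem_unitBall.1 (hD.subset hx)).le
  have hRne : R.Nonempty := hD.isConnected.nonempty.image _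
  have hRc : IsPreconnected R :=
    hD.isConnected.isPreconnected.image _ continuous_norm.continuousOn
  have hbb : BddBelow R := ⟨0, hR0⟩
  have hba : BddAbove R := ⟨1, hR1⟩
  have hIoo : Ioo (sInf R) (sSup R) ⊆ R := IsConnected.Ioo_csInf_csSup_subset ⟨hRne, hRc⟩ hbb hba
  -- By openness of `D` along a ray, the set of radii has no greatest element and no least element
  -- other than 0. The extreme radii therefore belong to the frontier.
  have hgt : ∀ t ∈ R, ∃ s ∈ R, t < s := fun t ht => by
    obtain ⟨ε, hε, hball⟩ := Metric.isOpen_iff.1 hTo t ((hTR t (hR0 t ht)).1 ht)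
    have h0 := hR0 t ht
    refine ⟨t + ε / 2, (hTR _ (by linarith)).2 (hball ?_), by linarith⟩
    rw [Metric.mem_ball, Real.dist_eq, add_sub_cancel_left, abs_of_pos (half_pos hε)]
    linarith
  have hlt : ∀ t ∈ R, 0 < t → ∃ s ∈ R, s < t := fun t ht h0 => by
    obtain ⟨ε, hε, hball⟩ := Metric.isOpen_iff.1 hTo t ((hTR t h0.le).1 ht)
    have h1 : 0 < min (ε / 2) t := lt_min (half_pos hε) h0
    refine ⟨t - min (ε / 2) t, (hTR _ (by linarith [min_le_right (ε / 2) t])).2 (hball ?_),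
      by linarith⟩
    rw [Metric.mem_ball, Real.dist_eq, sub_sub_cancel_left, abs_neg, abs_of_pos h1]
    linarith [min_le_left (ε / 2) t]
  have ha0 : 0 ≤ sInf R := le_csInf hRne hR0
  have hab : sInf R < sSup R := by
    obtain ⟨t, ht⟩ := hRne
    obtain ⟨s, hs, hts⟩ := hgt t ht
    exact (csInf_le hbb ht).trans_lt (hts.trans_le (le_csSup hba hs))
  have hclT : ∀ t ∈ Icc (sInf R) (sSup R), t • e ∈ closure D := fun t ht => by
    rw [← closure_Ioo hab.ne] at ht
    refine map_mem_closure (f := fun t : ℝ => t • e) hc ht fun s hs => ?_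
    exact (hTR s (ha0.trans hs.1.le)).1 (hIoo hs)
  refine ⟨sInf R, sSup R, ha0, hab, csSup_le hRne hR1, fun x hx => ?_, ?_, ?_⟩
  · obtain ⟨y, hy, hxy⟩ := hIoo hx
    exact hD.radial y x hxy hy
  · have hb0 : 0 ≤ sSup R := ha0.trans hab.le
    refine ⟨sSup R • e, ⟨hclT _ (right_mem_Icc.2 hab.le), ?_⟩, hnorm _ hb0⟩
    rw [hD.isOpen.interior_eq]
    intro h
    obtain ⟨s, hs, hlt'⟩ := hgt _ ((hTR _ hb0).2 h)
    exact absurd (le_csSup hba hs) (not_le.2 hlt')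
  · rcases ha0.eq_or_lt with h0 | h0
    · exact Or.inl h0.symm
    · refine Or.inr ⟨sInf R • e, ⟨hclT _ (left_mem_Icc.2 hab.le), ?_⟩, hnorm _ ha0⟩
      rw [hD.isOpen.interior_eq]
      intro h
      obtain ⟨s, hs, hlt'⟩ := hlt _ ((hTR _ ha0).2 h) h0
      exact absurd (csInf_le hbb hs) (not_le.2 hlt')

/-- Away from its frontier, an open set and the complement of its closure cover everything; a
connected set meeting the former stays in it. -/
lemma IsRadialDomain.subset_of_disjoint_frontier {D₁ D₂ : Set (EuclideanSpace ℝ (Fin n))}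
    (h₁ : IsRadialDomain D₁) (h₂ : IsRadialDomain D₂) (hne : (D₁ ∩ D₂).Nonempty)
    (hf : ∀ x ∈ D₁, x ∉ frontier D₂) : D₁ ⊆ D₂ := by
  refine h₁.isConnected.isPreconnected.subset_left_of_subset_union h₂.isOpen
    isClosed_closure.isOpen_compl
    (disjoint_compl_right.mono_left subset_closure) (fun x hx => ?_) hne
  by_contra h
  rw [mem_union, not_or, notMem_compl_iff] at h
  exact hf x hx ⟨h.2, by rw [h₂.isOpen.interior_eq]; exact h.1⟩

/-- A nonnegative radial solution on a domain does not cross zero inside this domain. -/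
lemma IsGeneralizedNodalDomain.notMem_frontier_of_nonneg {u g : ℝ → ℝ} (hg : Continuous g)
    (hg0 : g 0 = 0) (hug : ∀ r ∈ Icc (0 : ℝ) 1, u r = primitive g r)
    {D₁ D₂ : Set (EuclideanSpace ℝ (Fin n))} (h₁ : IsRadialDomain D₁)
    (hpos : ∀ x ∈ D₁, 0 ≤ u ‖x‖) (h₂ : IsGeneralizedNodalDomain u D₂) :
    ∀ x ∈ D₁, x ∉ frontier D₂ := by
  intro x hx hxf
  have hx1 : ‖x‖ < 1 := mem_unitBall.1 (h₁.subset hx)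
  have hx2 : ‖x‖ ∈ Icc (0 : ℝ) 1 := ⟨norm_nonneg x, hx1.le⟩
  have hd := h₂.boundary_deriv x hxf hx1
  have hz := h₂.boundary_zero x hxf
  rw [radialDeriv_eq hg hug hx2] at hd
  rcases eq_or_ne x 0 with rfl | hx0
  -- The slope vanishes at the origin, so the origin is never a frontier point with nonzero
  -- derivative.
  · exact hd (by rw [norm_zero, hg0])
  · have hxp : 0 < ‖x‖ := norm_pos_iff.2 hx0
    have hc : Continuous fun t : ℝ => (t / ‖x‖) • x := by fun_prop
    -- Along the ray through x the nonnegative profile attains the value 0 at an interior radius, so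
    -- its derivative vanishes there, contrary to the transversality condition on the frontier.
    refine hd (IsLocalMin.hasDerivAt_eq_zero ?_ (hasDerivAt_primitive hg ‖x‖))
    have hmem : (‖x‖ / ‖x‖) • x ∈ D₁ := by rwa [div_self hxp.ne', one_smul]
    filter_upwards [hc.continuousAt.eventually (h₁.isOpen.mem_nhds hmem), lt_mem_nhds hxp]
      with t ht ht0
    have htn : ‖(t / ‖x‖) • x‖ = t := by
      rw [norm_smul, norm_div, norm_norm, div_mul_cancel₀ _ hxp.ne', Real.norm_of_nonneg ht0.le]
    have ht1 : t < 1 := by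
      have := mem_unitBall.1 (h₁.subset ht)
      rwa [htn] at this
    have h := hpos _ ht
    rw [htn] at h
    rwa [← hug ‖x‖ hx2, hz, ← hug t ⟨ht0.le, ht1.le⟩]

/-- Finitely many exceptional radii cannot exhaust an open interval, so strict positivity occurs
somewhere. Nonnegativity reaches the end points by continuity. -/
lemma IsGeneralizedNodalDomain.isPosInterval (hn : 2 ≤ n) {u g : ℝ → ℝ} (hg : Continuous g)
    (hug : ∀ r ∈ Icc (0 : ℝ) 1, u r = primitive g r) {D : Set (EuclideanSpace ℝ (Fin n))}
    (hD : IsGeneralizedNodalDomain u D) (hpos : ∀ x ∈ D, 0 ≤ u ‖x‖)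
    {S : Finset ℝ} (hS : ∀ x ∈ D, ‖x‖ ∉ S → 0 < u ‖x‖) :
    ∃ a b : ℝ, IsPosInterval u a b ∧ ∀ x, ‖x‖ ∈ Ioo a b → x ∈ D := by
  have : Nonempty (Fin n) := ⟨⟨0, by omega⟩⟩
  obtain ⟨a, b, ha0, hab, hb1, hmem, ⟨xb, hxb, hxb'⟩, hleft⟩ :=
    hD.radialDomain.exists_radii hn
  have hIoo : ∀ r ∈ Ioo a b, ∃ x ∈ D, ‖x‖ = r := fun r hr => by
    obtain ⟨x, hx⟩ := exists_norm_eq (EuclideanSpace ℝ (Fin n)) (ha0.trans hr.1.le)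
    exact ⟨x, hmem x (hx ▸ hr), hx⟩
  have hΓ : Continuous (primitive g) :=
    continuous_iff_continuousAt.2 fun r => (hasDerivAt_primitive hg r).continuousAt
  refine ⟨a, b, ⟨ha0, hab, hb1, fun r hr => ?_, ?_, ?_, ?_⟩, hmem⟩
  · rw [hug r ⟨ha0.trans hr.1, hr.2.trans hb1⟩]
    rw [← closure_Ioo hab.ne] at hr
    refine (isClosed_le continuous_const hΓ).closure_subset_iff.2 (fun s hs => ?_) hr
    obtain ⟨x, hx, rfl⟩ := hIoo s hs
    change 0 ≤ primitive g ‖x‖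
    rw [← hug ‖x‖ ⟨norm_nonneg x, hs.2.le.trans hb1⟩]
    exact hpos x hx
  · exact hleft.imp id fun ⟨x, hx, hxa⟩ => hxa ▸ hD.boundary_zero x hx
  · exact hxb' ▸ hD.boundary_zero xb hxb
  · obtain ⟨r, hr, hrS⟩ := (Ioo_infinite hab).exists_notMem_finset S
    obtain ⟨x, hx, rfl⟩ := hIoo r hr
    exact ⟨‖x‖, hr, hS x hx hrS⟩

/-! ### Counting the nodal domains -/

lemma exists_primitive_sign {g : ℝ → ℝ} (hg : Continuous g) {b : ℝ} (hb : primitive g b = 0)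
    (hgb : 0 < g b) : ∃ δ > 0, (∀ r ∈ Ioo b (b + δ), 0 < primitive g r) ∧
      ∀ r ∈ Ioo (b - δ) b, primitive g r < 0 := by
  obtain ⟨δ, hδ, hball⟩ := Metric.isOpen_iff.1 (isOpen_lt continuous_const hg) b hgb
  have hpos : ∀ t, b - δ < t → t < b + δ → 0 < g t := fun t h1 h2 => hball (by
    rw [Metric.mem_ball, Real.dist_eq, abs_lt]
    constructor <;> linarith)
  refine ⟨δ, hδ, fun r hr => ?_, fun r hr => ?_⟩
  · have h1 := primitive_sub_primitive hg b r
    rw [hb, sub_zero] at h1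
    rw [h1]
    exact intervalIntegral.intervalIntegral_pos_of_pos_on (hg.intervalIntegrable _ _)
      (fun t ht => hpos t (by linarith [ht.1]) (ht.2.trans hr.2)) hr.1
  · have h1 := primitive_sub_primitive hg r b
    have h2 := intervalIntegral.intervalIntegral_pos_of_pos_on (hg.intervalIntegrable r b)
      (fun t ht => hpos t (hr.1.trans ht.1) (by linarith [ht.2])) hr.2
    rw [hb] at h1
    linarith

lemma continuous_primitive_of_continuous {g : ℝ → ℝ} (hg : Continuous g) :
    Continuous (primitive g) :=
  continuous_iff_continuousAt.2 fun r => (hasDerivAt_primitive hg r).continuousAt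

/-- A function positive in `(a, b)` and nonpositive at an end point vanishes there. -/
lemma eq_zero_of_pos_Ioo {h : ℝ → ℝ} (hc : Continuous h) {a b c : ℝ} (hab : a < b)
    (hpos : ∀ r ∈ Ioo a b, 0 < h r) (hmem : c ∈ Icc a b) (hle : h c ≤ 0) : h c = 0 := by
  refine le_antisymm hle ?_
  rw [← closure_Ioo hab.ne] at hmem
  exact (isClosed_le continuous_const hc).closure_subset_iff.2 (fun s hs => (hpos s hs).le) hmem

/-- A profile that is positive near `1` and vanishes at `1` has a last positivity interval. -/
lemma exists_isPosInterval_one {u g : ℝ → ℝ} (hg : Continuous g)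
    (hug : ∀ r ∈ Icc (0 : ℝ) 1, u r = primitive g r) {t : ℝ} (ht1 : t < 1)
    (ht : ∀ r ∈ Ioo t 1, 0 < u r) : ∃ d, IsPosInterval u d 1 := by
  have hΓ := continuous_primitive_of_continuous hg
  have hu1 : u 1 = 0 := by rw [hug 1 (by simp), primitive_one]
  suffices h : ∃ d, 0 ≤ d ∧ d < 1 ∧ (∀ r ∈ Ioo d 1, 0 < u r) ∧ (d = 0 ∨ primitive g d ≤ 0) by
    obtain ⟨d, hd0, hd1, hpos, hd⟩ := h
    have hpos' : ∀ r ∈ Ioo d 1, 0 < primitive g r := fun r hr => by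
      rw [← hug r ⟨hd0.trans hr.1.le, hr.2.le⟩]
      exact hpos r hr
    refine ⟨d, hd0, hd1, le_rfl, fun r hr => ?_, hd.imp id fun h => ?_, hu1, (d + 1) / 2, ?_, ?_⟩
    · rw [hug r ⟨hd0.trans hr.1, hr.2⟩]
      by_contra! hneg
      exact hneg.ne (eq_zero_of_pos_Ioo hΓ hd1 hpos' hr hneg.le)
    · rw [hug d ⟨hd0, hd1.le⟩]
      exact eq_zero_of_pos_Ioo hΓ hd1 hpos' (left_mem_Icc.2 hd1.le) h
    · constructor <;> linarith
    · exact hpos _ (by constructor <;> linarith)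
  -- The left end `d` is the last radius in [0, t] with u ≤ 0, or 0 when there is none.
  have hK : IsCompact (Icc 0 t ∩ {r | primitive g r ≤ 0}) :=
    isCompact_Icc.inter_right (isClosed_le hΓ continuous_const)
  rcases (Icc 0 t ∩ {r | primitive g r ≤ 0}).eq_empty_or_nonempty with hE | hne
  · have hpos : ∀ r ∈ Icc 0 t, 0 < primitive g r := fun r hr => by
      by_contra! h
      exact (hE ▸ (⟨hr, h⟩ : r ∈ Icc 0 t ∩ {r | primitive g r ≤ 0}) : r ∈ (∅ : Set ℝ))
    refine ⟨0, le_rfl, one_pos, fun r hr => ?_, Or.inl rfl⟩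
    rcases le_or_gt r t with h | h
    · rw [hug r ⟨hr.1.le, hr.2.le⟩]
      exact hpos r ⟨hr.1.le, h⟩
    · exact ht r ⟨h, hr.2⟩
  · obtain ⟨d, ⟨hd, hdle⟩, hmax⟩ := hK.exists_isGreatest hne
    refine ⟨d, hd.1, hd.2.trans_lt ht1, fun r hr => ?_, Or.inr hdle⟩
    rcases le_or_gt r t with h | h
    · have hr0 : 0 ≤ r := hd.1.trans hr.1.le
      rw [hug r ⟨hr0, hr.2.le⟩]
      by_contra! hneg
      exact absurd (hmax ⟨⟨hr0, h⟩, hneg⟩) (not_le.2 hr.1)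
    · exact ht r ⟨h, hr.2⟩

/-- To the right of a negative nodal domain there is a positivity interval. -/
lemma exists_isPosInterval_right {u g : ℝ → ℝ} (hg : Continuous g)
    (hug : ∀ r ∈ Icc (0 : ℝ) 1, u r = primitive g r) {b d : ℝ} (hb0 : 0 ≤ b) (hbd : b < d)
    (hd1 : d ≤ 1) (hub : u b = 0) (hud : u d = 0) (hgb : 0 < g b) :
    ∃ c ≤ d, IsPosInterval u b c := by
  have hΓ := continuous_primitive_of_continuous hg
  obtain ⟨δ, hδ, hpos, -⟩ := exists_primitive_sign hg
    (by rw [← hug b ⟨hb0, hbd.le.trans hd1⟩, hub]) hgb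
  -- The search for the first nonpositive radius starts strictly to the right of b, so that the zero
  -- at b itself is excluded; between b and r₁ positivity comes from the positive slope at b.
  set r₁ := min (b + δ / 2) ((b + d) / 2) with hr₁
  have hr₁b : b < r₁ := lt_min (by linarith) (by linarith)
  have hr₁d : r₁ < d := (min_le_right _ _).trans_lt (by linarith)
  have hr₁δ : r₁ < b + δ := (min_le_left _ _).trans_lt (by linarith)
  have hK : IsCompact (Icc r₁ d ∩ {r | primitive g r ≤ 0}) :=
    isCompact_Icc.inter_right (isClosed_le hΓ continuous_const)
  have hud' : primitive g d = 0 := by rw [← hug d ⟨hb0.trans hbd.le, hd1⟩, hud]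
  obtain ⟨c, ⟨hc, hcle⟩, hmin⟩ := hK.exists_isLeast ⟨d, right_mem_Icc.2 hr₁d.le, hud'.le⟩
  have hbc : b < c := hr₁b.trans_le hc.1
  have hpos' : ∀ r ∈ Ioo b c, 0 < primitive g r := fun r hr => by
    rcases lt_or_ge r r₁ with h | h
    · exact hpos r ⟨hr.1, h.trans hr₁δ⟩
    · by_contra! hneg
      exact absurd (hmin ⟨⟨h, hr.2.le.trans hc.2⟩, hneg⟩) (not_le.2 hr.2)
  have hI : ∀ r ∈ Icc b c, r ∈ Icc (0 : ℝ) 1 := fun r hr =>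
    ⟨hb0.trans hr.1, hr.2.trans (hc.2.trans hd1)⟩
  refine ⟨c, hc.2, hb0, hbc, hc.2.trans hd1, fun r hr => ?_, Or.inr hub, ?_, (b + c) / 2, ?_, ?_⟩
  · rw [hug r (hI r hr)]
    by_contra! hneg
    exact hneg.ne (eq_zero_of_pos_Ioo hΓ hbc hpos' hr hneg.le)
  · rw [hug c (hI c (right_mem_Icc.2 hbc.le))]
    exact eq_zero_of_pos_Ioo hΓ hbc hpos' (right_mem_Icc.2 hbc.le) hcle
  · constructor <;> linarith
  · rw [hug _ (hI _ ⟨by linarith, by linarith⟩)]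
    exact hpos' _ ⟨by linarith, by linarith⟩

/-- A nodal domain where the profile is negative ends where the last positivity interval begins,
if the profile has no two disjoint positivity intervals. -/
lemma IsGeneralizedNodalDomain.exists_radii_of_neg (hn : 2 ≤ n) {u g : ℝ → ℝ} (hg : Continuous g)
    (hug : ∀ r ∈ Icc (0 : ℝ) 1, u r = primitive g r)
    (huniq : ∀ a₁ b₁ a₂ b₂, IsPosInterval u a₁ b₁ → IsPosInterval u a₂ b₂ → ¬ b₁ ≤ a₂)
    {d : ℝ} (hd : IsPosInterval u d 1) {D : Set (EuclideanSpace ℝ (Fin n))}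
    (hD : IsGeneralizedNodalDomain u D) (hneg : ∀ x ∈ D, u ‖x‖ < 0) :
    ∃ a, 0 ≤ a ∧ a < d ∧ ∀ x, ‖x‖ ∈ Ioo a d → x ∈ D := by
  have : Nonempty (Fin n) := ⟨⟨0, by omega⟩⟩
  obtain ⟨a, b, ha0, hab, hb1, hmem, ⟨xb, hxb, hxb'⟩, -⟩ := hD.radialDomain.exists_radii hn
  have hIoo : ∀ r ∈ Ioo a b, u r < 0 := fun r hr => by
    obtain ⟨x, hx⟩ := exists_norm_eq (EuclideanSpace ℝ (Fin n)) (ha0.trans hr.1.le)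
    rw [← hx]
    exact hneg x (hmem x (hx ▸ hr))
  have hb0 : 0 < b := ha0.trans_lt hab
  -- Otherwise the negative shell would meet [d, 1], where u ≥ 0.
  have hbd : b ≤ d := by
    by_contra! h
    obtain ⟨r, hr1, hr2⟩ := exists_between (max_lt hab h)
    rw [max_lt_iff] at hr1
    exact absurd (hd.nonneg r ⟨hr1.2.le, hr2.le.trans hb1⟩) (not_le.2 (hIoo r ⟨hr1.1, hr2⟩))
  rcases hbd.eq_or_lt with rfl | hlt
  · exact ⟨a, ha0, hab, hmem⟩
  exfalso
  have hbI : b ∈ Icc (0 : ℝ) 1 := ⟨hb0.le, hb1⟩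
  have hub : u b = 0 := hxb' ▸ hD.boundary_zero xb hxb
  have hud : u d = 0 := hd.left.resolve_left (hb0.trans hlt).ne'
  have hgb : g b ≠ 0 := by
    have := hD.boundary_deriv xb hxb (hxb' ▸ hlt.trans hd.lt)
    rwa [hxb', radialDeriv_eq hg hug hbI] at this
  -- A negative slope at the zero b would make u positive just to its left, inside the negative
  -- domain; the sign lemma is applied to `-g`.
  have hgb' : 0 < g b := by
    refine lt_of_le_of_ne ?_ hgb.symm
    by_contra! h
    have hneg' : ∀ r, primitive (fun s => -g s) r = -primitive g r := fun r => by
      simp [primitive]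
    obtain ⟨δ, hδ, -, hleft⟩ := exists_primitive_sign (g := fun s => -g s) hg.neg (b := b)
      (by rw [hneg', ← hug b hbI, hub, neg_zero]) (by linarith)
    obtain ⟨r, hr1, hr2⟩ := exists_between (max_lt hab (by linarith : b - δ < b))
    rw [max_lt_iff] at hr1
    have h1 := hleft r ⟨hr1.2, hr2⟩
    rw [hneg', ← hug r ⟨ha0.trans hr1.1.le, hr2.le.trans hb1⟩] at h1
    linarith [hIoo r ⟨hr1.1, hr2⟩]
  -- The positivity interval starting at b ends no later than d, hence is disjoint from the last
  -- one.
  obtain ⟨c, hcd, hc⟩ := exists_isPosInterval_right hg hug hb0.le hlt hd.lt.le hub hud hgb'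
  exact huniq _ _ _ _ hc hd hcd

/-- At most two generalized nodal domains, for profiles without two disjoint positivity
intervals. -/
lemma encard_generalizedNodalDomain_le_two (hn : 2 ≤ n) {u g : ℝ → ℝ} (hg : Continuous g)
    (hg0 : g 0 = 0) (hug : ∀ r ∈ Icc (0 : ℝ) 1, u r = primitive g r)
    (huniq : ∀ a₁ b₁ a₂ b₂, IsPosInterval u a₁ b₁ → IsPosInterval u a₂ b₂ → ¬ b₁ ≤ a₂)
    {d : ℝ} (hd : IsPosInterval u d 1) :
    {D : Set (EuclideanSpace ℝ (Fin n)) | IsGeneralizedNodalDomain u D}.encard ≤ 2 := by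
  have : Nonempty (Fin n) := ⟨⟨0, by omega⟩⟩
  set N := {D : Set (EuclideanSpace ℝ (Fin n)) | IsGeneralizedNodalDomain u D ∧
    ∀ x ∈ D, u ‖x‖ < 0} with hN
  set P := {D : Set (EuclideanSpace ℝ (Fin n)) | IsGeneralizedNodalDomain u D ∧
    (∀ x ∈ D, 0 ≤ u ‖x‖) ∧ ∃ S : Finset ℝ, ∀ x ∈ D, ‖x‖ ∉ S → 0 < u ‖x‖} with hP
  have hsub : {D : Set (EuclideanSpace ℝ (Fin n)) | IsGeneralizedNodalDomain u D} ⊆ N ∪ P := by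
    intro D hD
    rcases hD.sign with h | ⟨h, S, -, hS⟩
    · exact Or.inl ⟨hD, h⟩
    · exact Or.inr ⟨hD, h, S, hS⟩
  have hinter : ∀ {D₁ D₂ : Set (EuclideanSpace ℝ (Fin n))} {a₁ b₁ a₂ b₂ : ℝ}, 0 ≤ a₁ →
      (∀ x, ‖x‖ ∈ Ioo a₁ b₁ → x ∈ D₁) → (∀ x, ‖x‖ ∈ Ioo a₂ b₂ → x ∈ D₂) →
      max a₁ a₂ < min b₁ b₂ → (D₁ ∩ D₂).Nonempty := by
    intro D₁ D₂ a₁ b₁ a₂ b₂ ha h₁ h₂ hlt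
    obtain ⟨r, hr1, hr2⟩ := exists_between hlt
    rw [max_lt_iff] at hr1
    rw [lt_min_iff] at hr2
    obtain ⟨x, rfl⟩ := exists_norm_eq (EuclideanSpace ℝ (Fin n)) (ha.trans hr1.1.le)
    exact ⟨x, h₁ x ⟨hr1.1, hr2.1⟩, h₂ x ⟨hr1.2, hr2.2⟩⟩
  -- All negative domains reach up to radius d and hence overlap; a frontier point of one, where u =
  -- 0, cannot lie in another.
  have hNs : N.Subsingleton := by
    have hsubset : ∀ D₁ ∈ N, ∀ D₂ ∈ N, D₁ ⊆ D₂ := by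
      rintro D₁ ⟨h₁, n₁⟩ D₂ ⟨h₂, n₂⟩
      obtain ⟨a₁, ha₁, hd₁, m₁⟩ := h₁.exists_radii_of_neg hn hg hug huniq hd n₁
      obtain ⟨a₂, ha₂, hd₂, m₂⟩ := h₂.exists_radii_of_neg hn hg hug huniq hd n₂
      refine h₁.radialDomain.subset_of_disjoint_frontier h₂.radialDomain
        (hinter ha₁ m₁ m₂ ?_) fun x hx hxf => ?_
      · rw [min_self]
        exact max_lt hd₁ hd₂
      · exact (n₁ x hx).ne (h₂.boundary_zero x hxf)
    exact fun D₁ h₁ D₂ h₂ => (hsubset _ h₁ _ h₂).antisymm (hsubset _ h₂ _ h₁)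
  have hPs : P.Subsingleton := by
    have hsubset : ∀ D₁ ∈ P, ∀ D₂ ∈ P, D₁ ⊆ D₂ := by
      rintro D₁ ⟨h₁, p₁, S₁, s₁⟩ D₂ ⟨h₂, p₂, S₂, s₂⟩
      obtain ⟨a₁, b₁, i₁, m₁⟩ := h₁.isPosInterval hn hg hug p₁ s₁
      obtain ⟨a₂, b₂, i₂, m₂⟩ := h₂.isPosInterval hn hg hug p₂ s₂
      refine h₁.radialDomain.subset_of_disjoint_frontier h₂.radialDomain
        (hinter i₁.nonneg_left m₁ m₂ ?_)
        (h₂.notMem_frontier_of_nonneg hg hg0 hug h₁.radialDomain p₁)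
      -- Neither positivity interval lies entirely to the left of the other, so the two overlap.
      have h12 := not_le.1 (huniq _ _ _ _ i₁ i₂)
      have h21 := not_le.1 (huniq _ _ _ _ i₂ i₁)
      exact max_lt (lt_min i₁.lt h21) (lt_min h12 i₂.lt)
    exact fun D₁ h₁ D₂ h₂ => (hsubset _ h₁ _ h₂).antisymm (hsubset _ h₂ _ h₁)
  calc _ ≤ (N ∪ P).encard := encard_le_encard hsub
    _ ≤ N.encard + P.encard := encard_union_le _ _
    _ ≤ 1 + 1 := add_le_add (encard_le_one_iff_subsingleton.2 hNs)
        (encard_le_one_iff_subsingleton.2 hPs)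
    _ = 2 := one_add_one_eq_two

/-! ### Conclusion for a general continuous positive weight -/

/-- The nodal domain theorem for a continuous positive weight. -/
lemma encard_generalizedNodalDomain_le_two_of_isEigenfunction (hn : 2 ≤ n)
    {V : EuclideanSpace ℝ (Fin n) → ℝ}
    (hVc : ContinuousOn V (Metric.closedBall 0 1)) (hV0 : ∀ x ∈ Metric.closedBall 0 1, 0 < V x)
    {lam : ℝ} (hlam : 0 ≤ lam) {u : ℝ → ℝ} (hu : ContinuousOn u (Icc 0 1))
    (hφ : IsEigenfunction lam V (firstEigenvalue lam V) (radialFun n u))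
    (hm : 0 ≤ average V (radialFun n u)) :
    {D : Set (EuclideanSpace ℝ (Fin n)) | IsGeneralizedNodalDomain u D}.encard ≤ 2 := by
  have hug := hφ.eq_primitive_slope hn hVc hu
  have hne : ¬ ∀ r ∈ Icc (0 : ℝ) 1, u r = 0 := fun h => hφ.1 (radialFun_ae_eq_zero h)
  have hm' : 0 < average V (radialFun n u) := lt_of_le_of_ne hm fun h =>
    hne (eq_zero_of_average_eq_zero hn hVc hV0 hu hug h.symm)
  -- If μ were 0, the slope, and with it the eigenfunction, would vanish identically.
  have hμ : 0 < lam + firstEigenvalue lam V := by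
    refine lt_of_le_of_ne (lam_add_firstEigenvalue_nonneg hlam fun x hx =>
      (hV0 x (Metric.ball_subset_closedBall hx)).le).1 fun h => hne fun r hr => ?_
    rw [hug r hr, ← h]
    simp [primitive, slope]
  have hg := continuous_slope hn hVc hu (lam + firstEigenvalue lam V)
  have hg0 : slope V u (lam + firstEigenvalue lam V) 0 = 0 := by
    rw [slope, ballMass_of_nonpos _ le_rfl, zero_div, mul_zero]
  obtain ⟨t, -, ht1, ht⟩ := exists_pos_near_one hn hVc hV0 hu hμ hug hm'
  obtain ⟨d, hd⟩ := exists_isPosInterval_one hg hug ht1 ht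
  exact encard_generalizedNodalDomain_le_two hn hg hg0 hug (fun a₁ b₁ a₂ b₂ h₁ h₂ h12 =>
    h₁.false_of_le hn hVc hV0 hu hlam hμ hug hm' h₂ h12) hd

/-! ### The weight of a solution, and the change of sign -/

lemma closure_unitBall : closure (unitBall n) = Metric.closedBall 0 1 :=
  closure_ball 0 one_ne_zero

lemma IsSolution.add_mul_pos {f : ℝ → ℝ} {lam α : ℝ} {ψ : EuclideanSpace ℝ (Fin n) → ℝ}
    (hψ : IsSolution f lam α ψ) (hlam : 0 ≤ lam) {x : EuclideanSpace ℝ (Fin n)}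
    (hx : x ∈ Metric.closedBall 0 1) : 0 < α + lam * ψ x := by
  have hnonneg : 0 ≤ ψ x := by
    by_cases h : x ∈ unitBall n
    · exact (hψ.pos x h).le
    · refine (hψ.boundary x ⟨closure_unitBall ▸ hx, ?_⟩).ge
      rwa [unitBall, Metric.isOpen_ball.interior_eq]
  have := hψ.alpha_pos
  positivity

/-- `f` is only controlled on [0, ∞), so its derivative is continuous on the open half-line. The
argument α + lam ψ stays there on the closed ball because α > 0 and ψ ≥ 0. -/
lemma IsSolution.continuousOn_weight {f : ℝ → ℝ} (hf : IsNonlinearity f) {lam α : ℝ}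
    {ψ : EuclideanSpace ℝ (Fin n) → ℝ} (hψ : IsSolution f lam α ψ) (hlam : 0 ≤ lam) :
    ContinuousOn (weight f lam α ψ) (Metric.closedBall 0 1) := by
  have hd : ContinuousOn (deriv f) (Ioi 0) :=
    (hf.contDiffOn.mono Ioi_subset_Ici_self).continuousOn_deriv_of_isOpen isOpen_Ioi (by norm_num)
  have hψc : ContinuousOn ψ (Metric.closedBall 0 1) := closure_unitBall ▸ hψ.contDiffOn.continuousOn
  exact hd.comp (continuousOn_const.add (continuousOn_const.mul hψc)) fun x hx =>
    hψ.add_mul_pos hlam hx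

lemma average_neg (V φ : EuclideanSpace ℝ (Fin n) → ℝ) :
    average V (fun x => -φ x) = -average V φ := by
  simp [average, integral_neg, neg_div]

lemma oscillation_neg (V φ : EuclideanSpace ℝ (Fin n) → ℝ) (x : EuclideanSpace ℝ (Fin n)) :
    oscillation V (fun x => -φ x) x = -oscillation V φ x := by
  rw [oscillation, oscillation, average_neg]
  ring

lemma IsTestFunction.neg {Ω : Set (EuclideanSpace ℝ (Fin n))}
    {η : EuclideanSpace ℝ (Fin n) → ℝ} (h : IsTestFunction Ω η) :
    IsTestFunction Ω fun x => -η x := by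
  have hs : tsupport (fun x => -η x) = tsupport η := by
    simp only [tsupport, Function.support_fun_neg]
  exact ⟨h.1.neg, by rw [HasCompactSupport, hs]; exact h.2.1, by rw [hs]; exact h.2.2⟩

lemma gradient_neg (η : EuclideanSpace ℝ (Fin n) → ℝ) (x : EuclideanSpace ℝ (Fin n)) :
    gradient (fun x => -η x) x = -gradient η x := by
  simp [gradient]

lemma MemH10.neg {Ω : Set (EuclideanSpace ℝ (Fin n))} {φ : EuclideanSpace ℝ (Fin n) → ℝ}
    {G : EuclideanSpace ℝ (Fin n) → EuclideanSpace ℝ (Fin n)} (h : MemH10 Ω φ G) :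
    MemH10 Ω (fun x => -φ x) fun x => -G x := by
  obtain ⟨hφ, hG, η, hη, l1, l2⟩ := h
  refine ⟨hφ.neg, hG.neg, fun k x => -η k x, fun k => (hη k).neg, ?_, ?_⟩
  · refine l1.congr fun k => ?_
    rw [← eLpNorm_neg]
    congr 1
    ext x
    simp only [Pi.neg_apply]
    ring
  · refine l2.congr fun k => ?_
    rw [← eLpNorm_neg]
    congr 1
    ext1 x
    rw [Pi.neg_apply, gradient_neg]
    exact neg_sub' _ _

lemma IsEigenfunction.neg {lam σ : ℝ} {V φ : EuclideanSpace ℝ (Fin n) → ℝ}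
    (h : IsEigenfunction lam V σ φ) : IsEigenfunction lam V σ fun x => -φ x := by
  obtain ⟨hne, G, hG, hweak⟩ := h
  refine ⟨fun h0 => hne (h0.mono fun x hx => by simpa using hx), fun x => -G x, hG.neg,
    fun η hη => ?_⟩
  have := hweak η hη
  simp only [oscillation_neg, inner_neg_left, mul_neg, neg_mul, integral_neg]
  linarith

end MeanField

end

/-- Every radial eigenfunction of the first eigenvalue, represented by its continuous radial
profile `u` and with its sign normalized so that its weighted average is nonnegative, has at most
two generalized nodal domains. -/
theorem mainTheorem1 (n : ℕ) (hn : 2 ≤ n) (f : ℝ → ℝ) (hf : MeanField.IsNonlinearity f)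
    (lam : ℝ) (hlam : 0 ≤ lam) (α : ℝ) (ψ : EuclideanSpace ℝ (Fin n) → ℝ)
    (hψ : MeanField.IsSolution f lam α ψ)
    (u : ℝ → ℝ) (hu : ContinuousOn u (Set.Icc 0 1))
    (hφ : MeanField.IsEigenfunction lam (MeanField.weight f lam α ψ)
      (MeanField.firstEigenvalue lam (MeanField.weight f lam α ψ)) (MeanField.radialFun n u)) :
    (0 ≤ MeanField.average (MeanField.weight f lam α ψ) (MeanField.radialFun n u) →
      {D : Set (EuclideanSpace ℝ (Fin n)) |
        MeanField.IsGeneralizedNodalDomain u D}.encard ≤ 2) ∧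
    (MeanField.average (MeanField.weight f lam α ψ) (MeanField.radialFun n u) ≤ 0 →
      {D : Set (EuclideanSpace ℝ (Fin n)) |
        MeanField.IsGeneralizedNodalDomain (fun r => -u r) D}.encard ≤ 2) := by
  have hVc := hψ.continuousOn_weight hf hlam
  have hV0 : ∀ x ∈ Metric.closedBall 0 1, 0 < MeanField.weight f lam α ψ x := fun x hx =>
    hf.deriv_pos _ (hψ.add_mul_pos hlam hx)
  refine ⟨MeanField.encard_generalizedNodalDomain_le_two_of_isEigenfunction hn hVc hV0 hlam hu hφ,
    fun hm => ?_⟩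
  refine MeanField.encard_generalizedNodalDomain_le_two_of_isEigenfunction hn hVc hV0 hlam hu.neg
    hφ.neg ?_
  have := MeanField.average_neg (MeanField.weight f lam α ψ) (MeanField.radialFun n u)
  exact (neg_nonneg.2 hm).trans_eq this.symm
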